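/- Let $A\in\mathbb R^{n\times n}$, $B\in\mathbb R^{n\times m}$, $C\in\mathbb R^{k\times n}$, let the pair $\{A,C\}$ be observable, and let $\tilde n\ge 1$ be the minimal natural number such that the stacked matrix with block rows $C, CA,\dots,CA^{\tilde n-1}$ has rank $n$. A square matrix is called anti-Hurwitz if all its eigenvalues have positive real parts. **1)** The linear algebraic equation $$AG_0-G_0A+Y_0C=A,\qquad CG_0=\mathbf 0$$ has a solution $Y_0\in\mathbb R^{n\times k}$, $G_0\in\mathbb R^{n\times n}$ such that a) the matrix $G_{\mathbf d}=I_n+\nu G_0$ is anti-Hurwitz for every real $\nu\ge -1/\tilde n$; b) the matrix $I_n+G_0$ is invertible, and $A_0=A-(I_n+G_0)^{-1}Y_0C$ satisfies $A_0G_{\mathbf d}=(G_{\mathbf d}+\nu I_n)A_0$ and $CG_{\mathbf d}=C$ for every $\nu\in\mathbb R$. Moreover, for every solution $(G_0,Y_0)$ with the properties a) and b), every $\nu\ge-1/\tilde n$ and every $\rho>0$, the following holds. **2)** The linear matrix inequality $$PA_0+A_0^\top P+YC+C^\top Y^\top+\rho(PG_{\mathbf d}+G_{\mathbf d}^\top P)\preceq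 0,\qquad PG_{\mathbf d}+G_{\mathbf d}^\top P\succ0,\qquad P=P^\top\succ0$$ has a solution $P\in\mathbb R^{n\times n}$, $Y\in\mathbb R^{n\times k}$. **3)** $\mathbf d(s)=e^{sG_{\mathbf d}}$ and $\tilde{\mathbf d}(s)=\begin{pmatrix}\mathbf d(s)&\mathbf 0\\ \mathbf 0&e^s\end{pmatrix}$, $s\in\mathbb R$, are dilations in $\mathbb R^n$ and $\mathbb R^{n+1}$ (continuous one-parameter groups of linear maps such that the norm of the image of every nonzero vector tends to $+\infty$ as $s\to+\infty$ and to $0$ as $s\to-\infty$), and for every $L\in\mathbb R^{n\times k}$ the error equation $$\frac{d}{dt}\begin{pmatrix}\varepsilon\\ \xi\end{pmatrix}=g_\xi(\varepsilon,\xi):=\begin{pmatrix}A_0\varepsilon+|\xi|^{\nu-1}\mathbf d(\ln|\xi|)LC\varepsilon\\ -\rho|\xi|^{\nu+1}\mathrm{sign}(\xi)\end{pmatrix}$$ is $\tilde{\mathbf d}$-homogeneous of degree $\nu$: $g_\xi(\tilde{\mathbf d}(s)\varepsilon_\xi)=e^{\nu s}\tilde{\mathbf d}(s)g_\xi(\varepsilon_\xi)$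 for all $s\in\mathbb R$ and all $\varepsilon_\xi=(\varepsilon,\xi)\in\mathbb R^{n+1}$ with $\xi\ne0$. **4)** Let $(P,Y)$ be any solution of the linear matrix inequality in 2), let $L_0=-(I_n+G_0)^{-1}Y_0$ and $L=P^{-1}Y$, and let $\xi_0\ne0$. Put $T_0=+\infty$ if $\nu\ge0$ and $T_0=\dfrac{|\xi_0|^{-\nu}}{-\nu\rho}<+\infty$ if $\nu<0$. Let $x$ be a solution of $\dot x=Ax+Bu$ on $[0,T_0)$ with an input $u$, and let $y=Cx$. Then for every $z_0\in\mathbb R^n$ the observer $$\dot z=Az+Bu+\bigl(L_0+|\xi|^{\nu-1}\mathbf d(\ln|\xi|)L\bigr)(Cz-y),\qquad \dot\xi=-\rho|\xi|^{1+\nu}\mathrm{sign}(\xi),\qquad z(0)=z_0,\quad \xi(0)=\xi_0,$$ has a solution on $[0,T_0)$, and for every such solution the error $\varepsilon_\xi=(z-x,\xi)$ satisfies $\varepsilon_\xi(t)\to\mathbf 0$ as $t\to T_0$; thus the error converges to zero in the fixed time $T_0<+\infty$ if $\nu<0$ and asymptotically ($T_0=+\infty$) if $\nu\ge0$. Solutions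 are understood in the Carathéodory sense (integral equations with locally integrable right-hand sides). -/

import Mathlib

open Matrix MeasureTheory Filter Topology

noncomputable section

/-- The stacked matrix with block rows `C, C A, …, C A^(N-1)`. -/
def obsMatrix {n k : ℕ} (A : Matrix (Fin n) (Fin n) ℝ) (C : Matrix (Fin k) (Fin n) ℝ) (N : ℕ) :
    Matrix (Fin N × Fin k) (Fin n) ℝ :=
  Matrix.of fun p j => (C * A ^ (p.1 : ℕ)) p.2 j

/-- The pair `{A, C}` is observable (Kalman rank condition). -/
def ObservablePair {n k : ℕ} (A : Matrix (Fin n) (Fin n) ℝ) (C : Matrix (Fin k) (Fin n) ℝ) : Prop :=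
  (obsMatrix A C n).rank = n

/-- `N` is the minimal number of blocks (at least one) for which the stacked matrix has rank `n`. -/
def IsObsIndex {n k : ℕ} (A : Matrix (Fin n) (Fin n) ℝ) (C : Matrix (Fin k) (Fin n) ℝ)
    (N : ℕ) : Prop :=
  IsLeast {M : ℕ | 1 ≤ M ∧ (obsMatrix A C M).rank = n} N

/-- All (complex) eigenvalues have positive real part. -/
def AntiHurwitz {n : ℕ} (G : Matrix (Fin n) (Fin n) ℝ) : Prop :=
  ∀ μ ∈ spectrum ℂ (G.map Complex.ofReal), 0 < μ.re

/-- The generator `G_d = I + ν G₀`. -/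
def genD {n : ℕ} (G₀ : Matrix (Fin n) (Fin n) ℝ) (ν : ℝ) : Matrix (Fin n) (Fin n) ℝ :=
  1 + ν • G₀

/-- The static gain `L₀ = -(I + G₀)⁻¹ Y₀`. -/
def gainL₀ {n k : ℕ} (G₀ : Matrix (Fin n) (Fin n) ℝ) (Y₀ : Matrix (Fin n) (Fin k) ℝ) :
    Matrix (Fin n) (Fin k) ℝ :=
  -((1 + G₀)⁻¹ * Y₀)

/-- `A₀ = A - (I + G₀)⁻¹ Y₀ C`. -/
def matA₀ {n k : ℕ} (A : Matrix (Fin n) (Fin n) ℝ) (C : Matrix (Fin k) (Fin n) ℝ)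
    (G₀ : Matrix (Fin n) (Fin n) ℝ) (Y₀ : Matrix (Fin n) (Fin k) ℝ) : Matrix (Fin n) (Fin n) ℝ :=
  A - (1 + G₀)⁻¹ * Y₀ * C

/-- `(G₀, Y₀)` solves the linear algebraic equation and has the two listed properties, where `N`
stands for the minimal number of blocks of the observability matrix. -/
structure IsHomogenizing {n k : ℕ} (A : Matrix (Fin n) (Fin n) ℝ) (C : Matrix (Fin k) (Fin n) ℝ)
    (N : ℕ) (G₀ : Matrix (Fin n) (Fin n) ℝ) (Y₀ : Matrix (Fin n) (Fin k) ℝ) : Prop where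
  eqn : A * G₀ - G₀ * A + Y₀ * C = A
  eqnC : C * G₀ = 0
  antiHurwitz : ∀ ν : ℝ, -1 / (N : ℝ) ≤ ν → AntiHurwitz (genD G₀ ν)
  invertible : IsUnit (1 + G₀)
  homA₀ : ∀ ν : ℝ, matA₀ A C G₀ Y₀ * genD G₀ ν =
    (genD G₀ ν + ν • (1 : Matrix (Fin n) (Fin n) ℝ)) * matA₀ A C G₀ Y₀
  homC : ∀ ν : ℝ, C * genD G₀ ν = C

/-- The linear matrix inequality in the unknowns `P`, `Y`
(`PosDef` contains the symmetry of the matrix). -/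
structure SolvesLMI {n k : ℕ} (A₀ : Matrix (Fin n) (Fin n) ℝ) (C : Matrix (Fin k) (Fin n) ℝ)
    (G : Matrix (Fin n) (Fin n) ℝ) (ρ : ℝ) (P : Matrix (Fin n) (Fin n) ℝ)
    (Y : Matrix (Fin n) (Fin k) ℝ) : Prop where
  lmi : (-(P * A₀ + A₀ᵀ * P + Y * C + Cᵀ * Yᵀ + ρ • (P * G + Gᵀ * P))).PosSemidef
  monotone : (P * G + Gᵀ * P).PosDef
  posDef : P.PosDef

/-- The continuous linear group `s ↦ exp (s G)`. -/
def expGroup {n : ℕ} (G : Matrix (Fin n) (Fin n) ℝ) (s : ℝ) : Matrix (Fin n) (Fin n) ℝ :=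
  NormedSpace.exp (s • G)

/-- The block-diagonal family `diag (exp (s G), e^s)`. -/
def extGroup {n : ℕ} (G : Matrix (Fin n) (Fin n) ℝ) (s : ℝ) :
    Matrix (Fin n ⊕ Unit) (Fin n ⊕ Unit) ℝ :=
  Matrix.fromBlocks (expGroup G s) 0 0 (Real.exp s • (1 : Matrix Unit Unit ℝ))

/-- A continuous linear dilation in `ℝ^ι`. -/
structure IsDilation {ι : Type*} [Fintype ι] [DecidableEq ι] (d : ℝ → Matrix ι ι ℝ) : Prop where
  zero : d 0 = 1
  add : ∀ s t : ℝ, d (s + t) = d s * d t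
  continuous : Continuous d
  expand : ∀ x : ι → ℝ, x ≠ 0 → Tendsto (fun s => ‖d s *ᵥ x‖) atTop atTop
  contract : ∀ x : ι → ℝ, x ≠ 0 → Tendsto (fun s => ‖d s *ᵥ x‖) atBot (𝓝 0)

/-- `f` is `d`-homogeneous of degree `μ` at the points of `S`. -/
def IsHomogeneousOn {ι : Type*} [Fintype ι] (d : ℝ → Matrix ι ι ℝ) (f : (ι → ℝ) → (ι → ℝ))
    (μ : ℝ) (S : Set (ι → ℝ)) : Prop :=
  ∀ s : ℝ, ∀ x ∈ S, d s *ᵥ x ∈ S ∧ f (d s *ᵥ x) = Real.exp (μ * s) • (d s *ᵥ f x)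

/-- The time-varying gain `|ξ|^(ν-1) d(ln |ξ|) L`, for `ξ ≠ 0`. -/
def gain {n k : ℕ} (G : Matrix (Fin n) (Fin n) ℝ) (L : Matrix (Fin n) (Fin k) ℝ) (ν ξ : ℝ) :
    Matrix (Fin n) (Fin k) ℝ :=
  |ξ| ^ (ν - 1) • (expGroup G (Real.log |ξ|) * L)

/-- Right-hand side of the equation `ξ' = -ρ |ξ|^(1+ν) sign ξ`. -/
def xiField (ρ ν ξ : ℝ) : ℝ := -ρ * |ξ| ^ (1 + ν) * Real.sign ξ

/-- The vector field of the extended error equation in the variable `(ε, ξ)`. -/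
def errorField {n k : ℕ} (A₀ : Matrix (Fin n) (Fin n) ℝ) (C : Matrix (Fin k) (Fin n) ℝ)
    (G : Matrix (Fin n) (Fin n) ℝ) (L : Matrix (Fin n) (Fin k) ℝ) (ρ ν : ℝ)
    (e : Fin n ⊕ Unit → ℝ) : Fin n ⊕ Unit → ℝ :=
  let ε : Fin n → ℝ := fun i => e (Sum.inl i)
  let ξ : ℝ := e (Sum.inr ())
  Sum.elim (A₀ *ᵥ ε + gain G L ν ξ *ᵥ (C *ᵥ ε)) (fun _ => xiField ρ ν ξ)

/-- `w` is a (Carathéodory) solution of `w' = f(t, w)` on the time interval `J` with left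
end point `0 ∈ J`. -/
def IsSolutionOn {E : Type*} [NormedAddCommGroup E] [NormedSpace ℝ E] (J : Set ℝ)
    (f : ℝ → E → E) (w : ℝ → E) : Prop :=
  ∀ t ∈ J, IntervalIntegrable (fun s => f s (w s)) volume 0 t ∧
    w t = w 0 + ∫ s in (0 : ℝ)..t, f s (w s)

/-- `x` is a solution of the plant `x' = A x + B u`. -/
def IsPlantSolution {n m : ℕ} (A : Matrix (Fin n) (Fin n) ℝ) (B : Matrix (Fin n) (Fin m) ℝ)
    (J : Set ℝ) (u : ℝ → Fin m → ℝ) (x : ℝ → Fin n → ℝ) : Prop :=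
  IsSolutionOn J (fun t v => A *ᵥ v + B *ᵥ u t) x

/-- `(z, ξ)` is a solution of the observer with input `u` and measured output `y`. -/
def IsObserverSolution {n m k : ℕ} (A : Matrix (Fin n) (Fin n) ℝ) (B : Matrix (Fin n) (Fin m) ℝ)
    (C : Matrix (Fin k) (Fin n) ℝ) (G : Matrix (Fin n) (Fin n) ℝ)
    (L₀ L : Matrix (Fin n) (Fin k) ℝ) (ρ ν : ℝ) (J : Set ℝ)
    (u : ℝ → Fin m → ℝ) (y : ℝ → Fin k → ℝ) (z : ℝ → Fin n → ℝ) (ξ : ℝ → ℝ) : Prop :=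
  IsSolutionOn J
      (fun t v => A *ᵥ v + B *ᵥ u t + (L₀ + gain G L ν (ξ t)) *ᵥ (C *ᵥ v - y t)) z ∧
    IsSolutionOn J (fun _ v => xiField ρ ν v) ξ

/-- For `ν < 0`, the time `|ξ₀|^(-ν) / (-ν ρ)`. -/
def settlingTime (ρ ν ξ₀ : ℝ) : ℝ := |ξ₀| ^ (-ν) / (-ν * ρ)

/-- The interval `[0, T₀)`, where `T₀ = +∞` for `ν ≥ 0`. -/
def horizon (ρ ν ξ₀ : ℝ) : Set ℝ :=
  if ν < 0 then Set.Ico 0 (settlingTime ρ ν ξ₀) else Set.Ici 0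

/-- The filter `t → T₀`, `t < T₀`, where `T₀ = +∞` for `ν ≥ 0`. -/
def toHorizon (ρ ν ξ₀ : ℝ) : Filter ℝ :=
  if ν < 0 then 𝓝[<] settlingTime ρ ν ξ₀ else atTop

end

/-!
Under the powers of `A` the output `C` cuts out a decreasing chain of unobservable subspaces.
Descending this chain one builds `G₀` so that it acts as multiplication by `i` on the `i`-th
quotient and `A` lowers the degree by one, up to an output injection `Y₀ C`. Every solution of the
algebraic equation then makes the rows of `C A₀ ^ j` left eigenvectors of `G_d = I + ν G₀` for the
eigenvalue `1 + ν j`; by observability `∏ (X - (1 + ν j))` annihilates `G_d`, so its eigenvalues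
are among the `1 + ν j`.

The matrix inequality is solved first on the zero space and then on larger and larger common
kernels of the `C A₀ ^ j`. Each step uses Finsler's lemma twice: a large multiple of
`(C A₀ ^ j)ᵀ (C A₀ ^ j)` restores the positivity, and one of the cross term of `C A₀ ^ (j - 1)` and
`C A₀ ^ j` the decrease along `A₀ + ρ G_d`.

By homogeneity the substitution `ε = d(ln |ξ|) w` turns the error equation into
`w' = |ξ| ^ ν (A₀ + L C + ρ G_d) w`. The matrix inequality says that `P` is a Lyapunov function of
this linear equation, so `w` stays bounded, and `d(ln |ξ|)` tends to zero along with `ξ`.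
-/

section Grading

variable {K V W : Type*} [Field K] [AddCommGroup V] [Module K V] [AddCommGroup W] [Module K W]

/-- The subspace of the states `v` with `c v = c (a v) = … = c (a ^ (j - 1) v) = 0`. These spaces
form the decreasing filtration along which the generator of the dilation is constructed. -/
def unobservable (a : V →ₗ[K] V) (c : V →ₗ[K] W) : ℕ → Submodule K V
  | 0 => ⊤
  | j + 1 => LinearMap.ker c ⊓ (unobservable a c j).comap a

theorem mem_unobservable_succ {a : V →ₗ[K] V} {c : V →ₗ[K] W} {j : ℕ} {v : V} :
    v ∈ unobservable a c (j + 1) ↔ c v = 0 ∧ a v ∈ unobservable a c j :=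
  Iff.rfl

theorem unobservable_antitone (a : V →ₗ[K] V) (c : V →ₗ[K] W) : Antitone (unobservable a c) := by
  refine antitone_nat_of_succ_le fun j => ?_
  induction j with
  | zero => exact le_top
  | succ j ih => exact fun v hv => ⟨hv.1, ih hv.2⟩

theorem mem_unobservable_iff {a : V →ₗ[K] V} {c : V →ₗ[K] W} {j : ℕ} {v : V} :
    v ∈ unobservable a c j ↔ ∀ i < j, c ((a ^ i) v) = 0 := by
  induction j generalizing v with
  | zero => simp [unobservable]
  | succ j ih => simp only [mem_unobservable_succ, ih, Nat.forall_lt_succ_left', pow_succ,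
      pow_zero, Module.End.mul_apply, Module.End.one_apply]

/-- `g` is a grading operator of the unobservable filtration from level `j` on: it acts as `i` on
the `i`-th quotient for `i ≥ j`, and `a` lowers the degree by one. The eigenspace `E` splits off
the top quotient; it is recorded because the next level has to be split along `a E`. -/
structure IsGradingFrom (a : V →ₗ[K] V) (c : V →ₗ[K] W) (j : ℕ) (E : Submodule K V)
    (g : V →ₗ[K] V) : Prop where
  le : E ≤ unobservable a c j
  disjoint : Disjoint E (unobservable a c (j + 1))
  le_sup : unobservable a c j ≤ unobservable a c (j + 1) ⊔ E
  apply_eq : ∀ v ∈ E, g v = (j : K) • v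
  sub_mem : ∀ i, j ≤ i → ∀ v ∈ unobservable a c i, g v - (i : K) • v ∈ unobservable a c (i + 1)
  apply_comm : ∀ v ∈ unobservable a c (j + 1), g (a v) = a (g v) - a v

variable {a : V →ₗ[K] V} {c : V →ₗ[K] W}

theorem isGradingFrom_of_eq_bot {j : ℕ} (h : unobservable a c j = ⊥) :
    IsGradingFrom a c j ⊥ 0 := by
  have eq_zero : ∀ i, j ≤ i → ∀ v ∈ unobservable a c i, v = 0 := fun i hi v hv => by
    simpa [h] using unobservable_antitone a c hi hv
  refine ⟨bot_le, disjoint_bot_left, by simp [h], by simp, fun i hi v hv => ?_, fun v hv => ?_⟩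
  · simp [eq_zero i hi v hv]
  · simp [eq_zero (j + 1) j.le_succ v hv]

theorem IsGradingFrom.disjoint_map {j : ℕ} {E : Submodule K V} {g : V →ₗ[K] V}
    (h : IsGradingFrom a c (j + 1) E g) : Disjoint (E.map a) (unobservable a c (j + 1)) := by
  rw [Submodule.disjoint_def]
  rintro _ ⟨v, hv, rfl⟩ hav
  have : v = 0 := Submodule.disjoint_def.1 h.disjoint v hv ⟨(h.le hv).1, hav⟩
  rw [this, map_zero]

theorem IsGradingFrom.exists_pred {j : ℕ} {E : Submodule K V} {g : V →ₗ[K] V}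
    (h : IsGradingFrom a c (j + 1) E g) : ∃ E' g', IsGradingFrom a c j E' g' := by
  obtain ⟨E', hE, hE'⟩ := h.disjoint_map.exists_isCompl
  have anti := unobservable_antitone a c
  let g' := LinearMap.ofIsCompl hE' ((j : K) • E'.subtype) (g ∘ₗ Submodule.subtype _)
  have g'_E : ∀ v ∈ E', g' v = (j : K) • v := fun v hv =>
    LinearMap.ofIsCompl_apply_left hE' ⟨v, hv⟩
  have g'_F : ∀ v ∈ unobservable a c (j + 1), g' v = g v := fun v hv =>
    LinearMap.ofIsCompl_apply_right hE' ⟨v, hv⟩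
  have le_sup : unobservable a c j ≤ unobservable a c (j + 1) ⊔ E' ⊓ unobservable a c j := by
    rw [← sup_inf_assoc_of_le _ (anti j.le_succ), hE'.symm.sup_eq_top, top_inf_eq]
  refine ⟨E' ⊓ unobservable a c j, g', inf_le_right, hE'.disjoint.mono_left inf_le_left, le_sup,
    fun v hv => g'_E v hv.1, fun i hi v hv => ?_, fun v hv => ?_⟩
  · rcases hi.eq_or_lt with rfl | hi
    · obtain ⟨u, hu, w, hw, rfl⟩ := Submodule.mem_sup.1 (le_sup hv)
      have key : g' (u + w) - (j : K) • (u + w) = (g u - ((j + 1 : ℕ) : K) • u) + u := by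
        rw [map_add, g'_F u hu, g'_E w hw.1]
        push_cast
        module
      rw [key]
      exact add_mem (anti (j + 1).le_succ (h.sub_mem _ le_rfl u hu)) hu
    · rw [g'_F v (anti hi hv)]
      exact h.sub_mem i hi v hv
  · obtain ⟨u, hu, w, hw, rfl⟩ := Submodule.mem_sup.1 (h.le_sup hv)
    rw [g'_F _ hv, map_add a, map_add g', g'_F _ hu.2, g'_E _ (hE (Submodule.mem_map_of_mem hw)),
      map_add g, h.apply_comm u hu, h.apply_eq w hw, map_add a, map_smul]
    push_cast
    module

theorem exists_grading {N : ℕ} (hN : unobservable a c N = ⊥) :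
    ∃ g : V →ₗ[K] V,
      (∀ i, ∀ v ∈ unobservable a c i, g v - (i : K) • v ∈ unobservable a c (i + 1)) ∧
      ∀ v, c v = 0 → g (a v) = a (g v) - a v := by
  have descend : ∀ j ≤ N, ∃ E g, IsGradingFrom a c (N - j) E g := by
    intro j
    induction j with
    | zero => exact fun _ => ⟨⊥, 0, isGradingFrom_of_eq_bot hN⟩
    | succ j ih =>
      intro hj
      obtain ⟨E, g, h⟩ := ih (Nat.le_of_succ_le hj)
      rw [show N - j = N - (j + 1) + 1 by omega] at h
      exact h.exists_pred
  obtain ⟨E, g, h⟩ := descend N le_rfl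
  rw [Nat.sub_self] at h
  exact ⟨g, fun i => h.sub_mem i i.zero_le, fun v hv => h.apply_comm v ⟨hv, trivial⟩⟩

theorem injective_one_add_of_grading [CharZero K] {g : V →ₗ[K] V} {N : ℕ}
    (hN : unobservable a c N = ⊥)
    (hg : ∀ i, ∀ v ∈ unobservable a c i, g v - (i : K) • v ∈ unobservable a c (i + 1)) :
    Function.Injective ⇑(1 + g : Module.End K V) := by
  refine (injective_iff_map_eq_zero _).2 fun v hv => ?_
  have g_v : g v = -v := (neg_eq_of_add_eq_zero_right hv).symm
  have mem : ∀ i, v ∈ unobservable a c i := by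
    intro i
    induction i with
    | zero => trivial
    | succ i ih =>
      have h := hg i v ih
      rw [g_v, show -v - (i : K) • v = -((i + 1 : ℕ) : K) • v by push_cast; module] at h
      exact (Submodule.smul_mem_iff _ (neg_ne_zero.2 (Nat.cast_ne_zero.2 i.succ_ne_zero))).1 h
  simpa [hN] using mem N

theorem exists_comp_eq_of_ker_le {U : Type*} [AddCommGroup U] [Module K U] (f : U →ₗ[K] V)
    (g : U →ₗ[K] W) (h : LinearMap.ker f ≤ LinearMap.ker g) : ∃ q : V →ₗ[K] W, q ∘ₗ f = g := by
  obtain ⟨q, hq⟩ := LinearMap.exists_extend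
    ((LinearMap.ker f).liftQ g h ∘ₗ f.quotKerEquivRange.symm.toLinearMap)
  refine ⟨q, LinearMap.ext fun u => ?_⟩
  simpa [LinearMap.quotKerEquivRange_symm_apply_image] using
    LinearMap.congr_fun hq ⟨f u, LinearMap.mem_range_self f u⟩

theorem exists_homogenizing_operator [CharZero K] {N : ℕ} (hN : unobservable a c N = ⊥) :
    ∃ (g : V →ₗ[K] V) (y : W →ₗ[K] V),
      a ∘ₗ g - g ∘ₗ a + y ∘ₗ c = a ∧ c ∘ₗ g = 0 ∧ Function.Injective ⇑(1 + g : Module.End K V) := by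
  obtain ⟨g, hg, hga⟩ := exists_grading hN
  obtain ⟨y, hy⟩ := exists_comp_eq_of_ker_le c (a + g ∘ₗ a - a ∘ₗ g) fun v hv => by
    simp [hga v hv]
  refine ⟨g, y, by rw [hy]; abel, LinearMap.ext fun v => ?_, injective_one_add_of_grading hN hg⟩
  simpa using (hg 0 v trivial).1

end Grading

section AlgebraicEquation

variable {n k : ℕ} {A : Matrix (Fin n) (Fin n) ℝ} {C : Matrix (Fin k) (Fin n) ℝ} {N : ℕ}
  {G₀ : Matrix (Fin n) (Fin n) ℝ} {Y₀ : Matrix (Fin n) (Fin k) ℝ}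

theorem unobservable_eq_bot_of_obsMatrix_rank (h : (obsMatrix A C N).rank = n) :
    unobservable (toLin' A) (toLin' C) N = ⊥ := by
  have ker_eq_bot := LinearMap.finrank_range_add_finrank_ker (obsMatrix A C N).mulVecLin
  rw [← Matrix.rank, h, Module.finrank_fin_fun, Nat.add_eq_left, Submodule.finrank_eq_zero]
    at ker_eq_bot
  rw [eq_bot_iff, ← ker_eq_bot]
  intro v hv
  ext p
  have := congrFun (mem_unobservable_iff.1 hv p.1 p.1.2) p.2
  rwa [← toLin'_pow, ← toLin'_mul_apply, toLin'_apply] at this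

theorem exists_homogenizing_matrix (h : (obsMatrix A C N).rank = n) :
    ∃ (G₀ : Matrix (Fin n) (Fin n) ℝ) (Y₀ : Matrix (Fin n) (Fin k) ℝ),
      A * G₀ - G₀ * A + Y₀ * C = A ∧ C * G₀ = 0 ∧ IsUnit (1 + G₀) := by
  obtain ⟨g, y, eqn, eqnC, inj⟩ :=
    exists_homogenizing_operator (unobservable_eq_bot_of_obsMatrix_rank h)
  refine ⟨g.toMatrix', y.toMatrix', ?_, ?_, Matrix.mulVec_injective_iff_isUnit.1 ?_⟩
  · simpa [LinearMap.toMatrix'_comp] using congrArg LinearMap.toMatrix' eqn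
  · simpa [LinearMap.toMatrix'_comp] using congrArg LinearMap.toMatrix' eqnC
  · intro v w hvw
    apply inj
    simpa [Matrix.add_mulVec, LinearMap.toMatrix'_mulVec] using hvw

end AlgebraicEquation

section AlgebraicEquation

open Polynomial

variable {n k : ℕ} {A : Matrix (Fin n) (Fin n) ℝ} {C : Matrix (Fin k) (Fin n) ℝ} {N : ℕ}
  {G₀ : Matrix (Fin n) (Fin n) ℝ} {Y₀ : Matrix (Fin n) (Fin k) ℝ}

theorem one_add_mul_matA₀ (eqn : A * G₀ - G₀ * A + Y₀ * C = A) (hinv : IsUnit (1 + G₀)) :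
    (1 + G₀) * matA₀ A C G₀ Y₀ = A * G₀ := by
  have h : Y₀ * C = A + G₀ * A - A * G₀ := by
    linear_combination (norm := abel) eqn
  rw [matA₀, mul_sub, Matrix.mul_assoc _ Y₀ C,
    Matrix.mul_nonsing_inv_cancel_left _ _ ((Matrix.isUnit_iff_isUnit_det _).1 hinv), h, add_mul,
    one_mul, sub_sub_cancel]

theorem matA₀_mul (eqn : A * G₀ - G₀ * A + Y₀ * C = A) (eqnC : C * G₀ = 0)
    (hinv : IsUnit (1 + G₀)) : matA₀ A C G₀ Y₀ * G₀ = (1 + G₀) * matA₀ A C G₀ Y₀ := by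
  rw [one_add_mul_matA₀ eqn hinv, matA₀, sub_mul, Matrix.mul_assoc _ C G₀, eqnC, Matrix.mul_zero,
    sub_zero]

theorem matA₀_mul_genD (eqn : A * G₀ - G₀ * A + Y₀ * C = A) (eqnC : C * G₀ = 0)
    (hinv : IsUnit (1 + G₀)) (ν : ℝ) :
    matA₀ A C G₀ Y₀ * genD G₀ ν = (genD G₀ ν + ν • 1) * matA₀ A C G₀ Y₀ := by
  rw [genD, mul_add, mul_one, mul_smul_comm, matA₀_mul eqn eqnC hinv]
  simp only [add_mul, one_mul, smul_mul_assoc, smul_add]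
  abel

theorem mul_genD (eqnC : C * G₀ = 0) (ν : ℝ) : C * genD G₀ ν = C := by
  rw [genD, Matrix.mul_add, Matrix.mul_one, Matrix.mul_smul, eqnC, smul_zero, add_zero]

theorem mul_matA₀_pow_mul (eqn : A * G₀ - G₀ * A + Y₀ * C = A) (eqnC : C * G₀ = 0)
    (hinv : IsUnit (1 + G₀)) (j : ℕ) :
    C * matA₀ A C G₀ Y₀ ^ j * G₀ = (j : ℝ) • (C * matA₀ A C G₀ Y₀ ^ j) := by
  induction j with
  | zero => simp [eqnC]
  | succ j ih =>
    rw [pow_succ, ← Matrix.mul_assoc C, Matrix.mul_assoc _ _ G₀, matA₀_mul eqn eqnC hinv,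
      ← Matrix.mul_assoc, Matrix.mul_add, Matrix.mul_one, ih, Matrix.add_mul, Matrix.smul_mul]
    push_cast
    module

theorem mul_matA₀_pow_mul_genD (eqn : A * G₀ - G₀ * A + Y₀ * C = A) (eqnC : C * G₀ = 0)
    (hinv : IsUnit (1 + G₀)) (ν : ℝ) (j : ℕ) :
    C * matA₀ A C G₀ Y₀ ^ j * genD G₀ ν = (1 + ν * j) • (C * matA₀ A C G₀ Y₀ ^ j) := by
  rw [genD, Matrix.mul_add, Matrix.mul_one, Matrix.mul_smul, mul_matA₀_pow_mul eqn eqnC hinv]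
  module

theorem unobservable_congr {K V W : Type*} [Field K] [AddCommGroup V] [Module K V]
    [AddCommGroup W] [Module K W] {a a' : V →ₗ[K] V} {c : V →ₗ[K] W}
    (h : ∀ v, c v = 0 → a v = a' v) (j : ℕ) : unobservable a c j = unobservable a' c j := by
  induction j with
  | zero => rfl
  | succ j ih =>
    ext v
    simp only [mem_unobservable_succ, ih]
    exact and_congr_right fun hv => by rw [h v hv]

theorem eq_zero_of_forall_mul_matA₀_pow_mulVec (h : (obsMatrix A C N).rank = n) {v : Fin n → ℝ}
    (hv : ∀ j < N, (C * matA₀ A C G₀ Y₀ ^ j) *ᵥ v = 0) : v = 0 := by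
  have congr : ∀ v, toLin' C v = 0 → toLin' (matA₀ A C G₀ Y₀) v = toLin' A v := fun v hv => by
    rw [toLin'_apply] at hv
    rw [toLin'_apply, matA₀, Matrix.sub_mulVec, ← Matrix.mulVec_mulVec, hv, Matrix.mulVec_zero,
      sub_zero, toLin'_apply]
  have mem : v ∈ unobservable (toLin' (matA₀ A C G₀ Y₀)) (toLin' C) N :=
    mem_unobservable_iff.2 fun j hj => by
      rw [← toLin'_pow, ← toLin'_mul_apply]
      exact hv j hj
  rwa [unobservable_congr congr, unobservable_eq_bot_of_obsMatrix_rank h] at mem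

theorem mul_aeval_of_mul_eq_smul {R m ι : Type*} [CommRing R] [Fintype ι] [DecidableEq ι]
    {M : Matrix m ι R} {G : Matrix ι ι R} {c : R} (h : M * G = c • M) (p : R[X]) :
    M * aeval G p = p.eval c • M := by
  induction p using Polynomial.induction_on' with
  | add p q hp hq => rw [map_add, Matrix.mul_add, hp, hq, eval_add, add_smul]
  | monomial j r =>
    rw [aeval_monomial, eval_monomial, ← Algebra.smul_def, Matrix.mul_smul, mul_smul]
    congr 1
    induction j with
    | zero => simp
    | succ j ih => rw [pow_succ, ← Matrix.mul_assoc, ih, Matrix.smul_mul, h, smul_smul, pow_succ]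

theorem aeval_genD_prod_eq_zero (h : (obsMatrix A C N).rank = n)
    (eqn : A * G₀ - G₀ * A + Y₀ * C = A) (eqnC : C * G₀ = 0) (hinv : IsUnit (1 + G₀)) (ν : ℝ) :
    aeval (genD G₀ ν) (∏ j ∈ Finset.range N, (X - Polynomial.C (1 + ν * (j : ℝ)))) = 0 := by
  refine Matrix.ext_of_mulVec_single fun i => ?_
  rw [Matrix.zero_mulVec]
  refine eq_zero_of_forall_mul_matA₀_pow_mulVec (G₀ := G₀) (Y₀ := Y₀) h fun j hj => ?_
  rw [Matrix.mulVec_mulVec,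
    mul_aeval_of_mul_eq_smul (mul_matA₀_pow_mul_genD eqn eqnC hinv ν j), eval_prod,
    Finset.prod_eq_zero (Finset.mem_range.2 hj) (by simp), zero_smul, Matrix.zero_mulVec]

theorem aeval_eq_zero_of_mem_spectrum_map {M : Matrix (Fin n) (Fin n) ℝ} {p : ℝ[X]}
    (hp : aeval M p = 0) {μ : ℂ} (hμ : μ ∈ spectrum ℂ (M.map Complex.ofReal)) :
    aeval μ p = 0 := by
  have mem := spectrum.subset_polynomial_aeval (M.map Complex.ofReal)
    (p.map (algebraMap ℝ ℂ)) ⟨μ, hμ, rfl⟩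
  have map_eq : M.map Complex.ofReal = (Algebra.ofId ℝ ℂ).mapMatrix M := rfl
  rw [aeval_map_algebraMap, map_eq, aeval_algHom_apply, hp, map_zero] at mem
  contrapose! mem
  rw [spectrum.mem_iff, not_not, sub_zero]
  refine (IsUnit.mk0 _ ?_).map (algebraMap ℂ (Matrix (Fin n) (Fin n) ℂ))
  simpa using mem

theorem one_add_mul_pos {ν : ℝ} (hν : -1 / (N : ℝ) ≤ ν) {j : ℕ} (hj : j < N) :
    0 < 1 + ν * j := by
  have hN : (0 : ℝ) < N := by exact_mod_cast (Nat.zero_le j).trans_lt hj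
  have hj' : (j : ℝ) < N := by exact_mod_cast hj
  rcases le_or_gt 0 ν with h | h
  · positivity
  · rw [div_le_iff₀ hN] at hν
    nlinarith

theorem antiHurwitz_genD (h : (obsMatrix A C N).rank = n)
    (eqn : A * G₀ - G₀ * A + Y₀ * C = A) (eqnC : C * G₀ = 0) (hinv : IsUnit (1 + G₀)) {ν : ℝ}
    (hν : -1 / (N : ℝ) ≤ ν) : AntiHurwitz (genD G₀ ν) := by
  intro μ hμ
  have root := aeval_eq_zero_of_mem_spectrum_map (aeval_genD_prod_eq_zero h eqn eqnC hinv ν) hμ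
  simp only [map_prod, Finset.prod_eq_zero_iff, Finset.mem_range, map_sub, aeval_X, aeval_C,
    sub_eq_zero] at root
  obtain ⟨j, hj, rfl⟩ := root
  simpa using one_add_mul_pos hν hj

theorem isHomogenizing_of_eqn (h : (obsMatrix A C N).rank = n)
    (eqn : A * G₀ - G₀ * A + Y₀ * C = A) (eqnC : C * G₀ = 0) (hinv : IsUnit (1 + G₀)) :
    IsHomogenizing A C N G₀ Y₀ where
  eqn := eqn
  eqnC := eqnC
  antiHurwitz _ hν := antiHurwitz_genD h eqn eqnC hinv hν
  invertible := hinv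
  homA₀ := matA₀_mul_genD eqn eqnC hinv
  homC := mul_genD eqnC

theorem AntiHurwitz.pos_of_mul_eq_smul {m : Type*} {G : Matrix (Fin n) (Fin n) ℝ}
    (hG : AntiHurwitz G) {M : Matrix m (Fin n) ℝ} {c : ℝ} (h : M * G = c • M) (hM : M ≠ 0) :
    0 < c := by
  refine hG c (spectrum.mem_iff.2 fun hunit => hM ?_)
  have map_eq : algebraMap ℂ (Matrix (Fin n) (Fin n) ℂ) c - G.map Complex.ofReal =
      Complex.ofRealHom.mapMatrix (c • 1 - G) := by
    ext i j
    simp [Matrix.algebraMap_matrix_apply, Matrix.one_apply, apply_ite]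
  rw [map_eq, Matrix.isUnit_iff_isUnit_det, ← RingHom.map_det, isUnit_map_iff] at hunit
  rw [← Matrix.mul_nonsing_inv_cancel_right _ M hunit, Matrix.mul_sub, h, Matrix.mul_smul,
    Matrix.mul_one, sub_self, Matrix.zero_mul]

end AlgebraicEquation

section LinearMatrixInequality

variable {ι κ : Type*} [Fintype ι]

/-- The quadratic form of `P` is positive definite on the subspace `K`. Allowing `K ≠ ⊤` lets the
solution of the matrix inequality be built up along a chain of subspaces. -/
def PosOn (K : Submodule ℝ (ι → ℝ)) (P : Matrix ι ι ℝ) : Prop :=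
  ∀ x ∈ K, x ≠ 0 → 0 < x ⬝ᵥ P *ᵥ x

theorem posOn_bot (P : Matrix ι ι ℝ) : PosOn ⊥ P :=
  fun _ hx hx0 => (hx0 hx).elim

theorem PosOn.congr {K : Submodule ℝ (ι → ℝ)} {P Q : Matrix ι ι ℝ} (h : PosOn K P)
    (hPQ : ∀ x ∈ K, x ⬝ᵥ Q *ᵥ x = x ⬝ᵥ P *ᵥ x) : PosOn K Q :=
  fun x hx hx0 => hPQ x hx ▸ h x hx hx0

theorem dotProduct_add_transpose_mulVec (M : Matrix ι ι ℝ) (x : ι → ℝ) :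
    x ⬝ᵥ (M + Mᵀ) *ᵥ x = 2 * (x ⬝ᵥ M *ᵥ x) := by
  rw [Matrix.add_mulVec, dotProduct_add, Matrix.mulVec_transpose, dotProduct_comm x (x ᵥ* M),
    ← Matrix.dotProduct_mulVec, two_mul]

theorem PosOn.posDef_add_transpose {M : Matrix ι ι ℝ} (h : PosOn ⊤ M) : (M + Mᵀ).PosDef := by
  refine .of_dotProduct_mulVec_pos (Matrix.isHermitian_add_transpose_self M) fun x hx => ?_
  rw [star_trivial, dotProduct_add_transpose_mulVec]
  exact mul_pos two_pos (h x trivial hx)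

theorem PosOn.posDef {P : Matrix ι ι ℝ} (h : PosOn ⊤ P) (hP : P.IsSymm) : P.PosDef :=
  .of_dotProduct_mulVec_pos hP fun x hx => by simpa using h x trivial hx

/-- Finsler's lemma. -/
theorem eventually_posOn_add_smul {K : Submodule ℝ (ι → ℝ)} {P Q : Matrix ι ι ℝ}
    (hQ : ∀ x ∈ K, 0 ≤ x ⬝ᵥ Q *ᵥ x)
    (hP : ∀ x ∈ K, x ⬝ᵥ Q *ᵥ x = 0 → x ≠ 0 → 0 < x ⬝ᵥ P *ᵥ x) :
    ∀ᶠ μ : ℝ in atTop, PosOn K (P + μ • Q) := by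
  let T : Set (ι → ℝ) := {x | x ∈ Metric.sphere 0 1 ∩ (K : Set (ι → ℝ)) ∧ x ⬝ᵥ P *ᵥ x ≤ 0}
  have ne_zero : ∀ x ∈ T, x ≠ 0 := fun x hx => Metric.ne_of_mem_sphere hx.1.1 one_ne_zero
  have Q_pos : ∀ x ∈ T, 0 < x ⬝ᵥ Q *ᵥ x := fun x hx =>
    (hQ x hx.1.2).lt_of_ne' fun h => hx.2.not_gt (hP x hx.1.2 h (ne_zero x hx))
  have T_compact : IsCompact T :=
    ((isCompact_sphere 0 1).inter_right K.closed_of_finiteDimensional).inter_right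
      (isClosed_le (f := fun x => x ⬝ᵥ P *ᵥ x) (g := 0) (by fun_prop) continuous_const)
  obtain ⟨B, hB⟩ := T_compact.bddAbove_image (f := fun x => -(x ⬝ᵥ P *ᵥ x) / (x ⬝ᵥ Q *ᵥ x))
    (ContinuousOn.div (by fun_prop) (by fun_prop) fun x hx => (Q_pos x hx).ne')
  filter_upwards [eventually_gt_atTop B, eventually_ge_atTop 0] with μ hμB hμ
  have unit_pos : ∀ x ∈ Metric.sphere 0 1 ∩ (K : Set (ι → ℝ)), 0 < x ⬝ᵥ (P + μ • Q) *ᵥ x := by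
    intro x hx
    rw [Matrix.add_mulVec, Matrix.smul_mulVec, dotProduct_add, dotProduct_smul, smul_eq_mul]
    rcases lt_or_ge 0 (x ⬝ᵥ P *ᵥ x) with h | h
    · exact add_pos_of_pos_of_nonneg h (mul_nonneg hμ (hQ x hx.2))
    · have bound := (hB ⟨x, ⟨hx, h⟩, rfl⟩).trans_lt hμB
      rw [div_lt_iff₀ (Q_pos x ⟨hx, h⟩)] at bound
      linarith
  intro x hx hx0
  have h := unit_pos (‖x‖⁻¹ • x) ⟨by simp [norm_smul, hx0], K.smul_mem _ hx⟩
  rw [Matrix.mulVec_smul, dotProduct_smul, smul_dotProduct, smul_smul, smul_eq_mul] at h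
  exact pos_of_mul_pos_right h (by positivity)

/-- The common kernel of `M 0, …, M (j - 1)`. -/
def commonKer (M : ℕ → Matrix κ ι ℝ) (j : ℕ) : Submodule ℝ (ι → ℝ) :=
  ⨅ i < j, LinearMap.ker (M i).mulVecLin

theorem mem_commonKer {M : ℕ → Matrix κ ι ℝ} {j : ℕ} {x : ι → ℝ} :
    x ∈ commonKer M j ↔ ∀ i < j, M i *ᵥ x = 0 := by
  simp [commonKer]

theorem mem_commonKer_succ {M : ℕ → Matrix κ ι ℝ} {j : ℕ} {x : ι → ℝ} :
    x ∈ commonKer M (j + 1) ↔ x ∈ commonKer M j ∧ M j *ᵥ x = 0 := by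
  simp only [mem_commonKer, Nat.forall_lt_succ_right]

variable {M : ℕ → Matrix κ ι ℝ} {G F P : Matrix ι ι ℝ} {j : ℕ}

/-- `P` is symmetric and its quadratic form is, on the common kernel of `M 0, …, M (j - 1)`,
positive definite, increasing under the dilation generated by `G` and decreasing along `F`. -/
structure IsLyapunovOn (M : ℕ → Matrix κ ι ℝ) (G F : Matrix ι ι ℝ) (j : ℕ) (P : Matrix ι ι ℝ) :
    Prop where
  symm : P.IsSymm
  pos : PosOn (commonKer M j) P
  monotone : PosOn (commonKer M j) (P * G)
  decreasing : PosOn (commonKer M j) (-(P * F))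

theorem isLyapunovOn_zero_of_eq_bot (h : commonKer M j = ⊥) : IsLyapunovOn M G F j 0 := by
  refine ⟨Matrix.isSymm_zero, ?_, ?_, ?_⟩ <;> exact h ▸ posOn_bot _

section CrossTerm

variable [Fintype κ]

theorem dotProduct_transpose_mul_mulVec (M L : Matrix κ ι ℝ) (x y : ι → ℝ) :
    x ⬝ᵥ (Mᵀ * L) *ᵥ y = (M *ᵥ x) ⬝ᵥ (L *ᵥ y) := by
  rw [← Matrix.mulVec_mulVec, Matrix.dotProduct_mulVec, Matrix.vecMul_transpose]

/-- The symmetric form `2 ⟨L x, M x⟩`. It vanishes on the kernel of `L`, but its derivative along a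
vector field need not. -/
def crossTerm (L M : Matrix κ ι ℝ) : Matrix ι ι ℝ :=
  Lᵀ * M + Mᵀ * L

theorem dotProduct_crossTerm_mulVec {L M : Matrix κ ι ℝ} {x : ι → ℝ} (hx : L *ᵥ x = 0) :
    x ⬝ᵥ crossTerm L M *ᵥ x = 0 := by
  simp only [crossTerm, Matrix.add_mulVec, dotProduct_add, dotProduct_transpose_mul_mulVec, hx,
    zero_dotProduct, dotProduct_zero, add_zero]

theorem dotProduct_crossTerm_mul_mulVec {L M : Matrix κ ι ℝ} {x : ι → ℝ} (hx : L *ᵥ x = 0)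
    (F : Matrix ι ι ℝ) :
    x ⬝ᵥ (crossTerm L M * F) *ᵥ x = (M *ᵥ x) ⬝ᵥ ((L * F) *ᵥ x) := by
  simp only [crossTerm, Matrix.add_mul, Matrix.mul_assoc, Matrix.add_mulVec, dotProduct_add,
    dotProduct_transpose_mul_mulVec, hx, zero_dotProduct, zero_add]

theorem PosOn.eventually_add_smul_transpose_mul {Q : Matrix ι ι ℝ} {c : ℝ} (hc : 0 < c)
    (hQ : PosOn (commonKer M (j + 1)) Q) :
    ∀ᶠ l : ℝ in atTop, PosOn (commonKer M j) (Q + l • (c • ((M j)ᵀ * M j))) := by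
  have form : ∀ x, x ⬝ᵥ (c • ((M j)ᵀ * M j)) *ᵥ x = c * ((M j *ᵥ x) ⬝ᵥ (M j *ᵥ x)) := fun x => by
    rw [Matrix.smul_mulVec, dotProduct_smul, dotProduct_transpose_mul_mulVec, smul_eq_mul]
  refine eventually_posOn_add_smul (fun x _ => ?_) fun x hx h hx0 => ?_
  · rw [form]
    exact mul_nonneg hc.le (by simpa using dotProduct_star_self_nonneg (M j *ᵥ x))
  · rw [form, mul_eq_zero, or_iff_right hc.ne', dotProduct_self_eq_zero] at h
    exact hQ x (mem_commonKer_succ.2 ⟨hx, h⟩) hx0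

end CrossTerm

variable [Finite κ]

theorem IsLyapunovOn.exists_extend_pos (hP : IsLyapunovOn M G F (j + 1) P)
    (hG : ∃ c > (0 : ℝ), M j * G = c • M j) : ∃ P' : Matrix ι ι ℝ, P'.IsSymm ∧
      PosOn (commonKer M j) P' ∧ PosOn (commonKer M j) (P' * G) ∧
      PosOn (commonKer M (j + 1)) (-(P' * F)) := by
  cases nonempty_fintype κ
  obtain ⟨c, hc, hG⟩ := hG
  obtain ⟨l, h_pos, h_monotone⟩ := ((hP.pos.eventually_add_smul_transpose_mul one_pos).and
    (hP.monotone.eventually_add_smul_transpose_mul hc)).exists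
  refine ⟨P + l • ((M j)ᵀ * M j), ?_, by simpa using h_pos, ?_, hP.decreasing.congr fun x hx => ?_⟩
  · exact hP.symm.add (.smul (by simp [Matrix.IsSymm]) l)
  · simpa only [add_mul, smul_mul_assoc, Matrix.mul_assoc, hG, Matrix.mul_smul] using h_monotone
  · simp only [add_mul, smul_mul_assoc, Matrix.mul_assoc, neg_add, Matrix.add_mulVec,
      Matrix.neg_mulVec, Matrix.smul_mulVec, dotProduct_add, dotProduct_neg, dotProduct_smul,
      dotProduct_transpose_mul_mulVec, (mem_commonKer_succ.1 hx).2, zero_dotProduct, smul_zero,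
      neg_zero, add_zero]

theorem IsLyapunovOn.exists_pred (hP : IsLyapunovOn M G F (j + 2) P)
    (hG : ∀ i, ∃ c > (0 : ℝ), M i * G = c • M i) (hF : ∃ c : ℝ, M j * F = M (j + 1) + c • M j) :
    ∃ P', IsLyapunovOn M G F (j + 1) P' := by
  cases nonempty_fintype κ
  obtain ⟨P₁, symm, pos, monotone, decreasing⟩ := hP.exists_extend_pos (hG (j + 1))
  obtain ⟨c, -, hG⟩ := hG j
  obtain ⟨d, hF⟩ := hF
  -- On the kernel of `M j`, subtracting `μ • S` changes neither `P` nor `P G`, but adds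
  -- `μ |M (j + 1) x|²` to the decrease along `F`.
  let S := crossTerm (M j) (M (j + 1))
  have ker : ∀ x ∈ commonKer M (j + 1), M j *ᵥ x = 0 := fun x hx => (mem_commonKer_succ.1 hx).2
  have SG_form : ∀ x ∈ commonKer M (j + 1), x ⬝ᵥ (S * G) *ᵥ x = 0 := fun x hx => by
    rw [dotProduct_crossTerm_mul_mulVec (ker x hx), hG, Matrix.smul_mulVec, ker x hx, smul_zero,
      dotProduct_zero]
  have SF_form : ∀ x ∈ commonKer M (j + 1),
      x ⬝ᵥ (S * F) *ᵥ x = (M (j + 1) *ᵥ x) ⬝ᵥ (M (j + 1) *ᵥ x) := fun x hx => by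
    rw [dotProduct_crossTerm_mul_mulVec (ker x hx), hF, Matrix.add_mulVec, Matrix.smul_mulVec,
      ker x hx, smul_zero, add_zero]
  obtain ⟨μ, hμ⟩ := (eventually_posOn_add_smul (P := -(P₁ * F)) (Q := S * F)
    (fun x hx => by simpa [SF_form x hx] using dotProduct_star_self_nonneg (M (j + 1) *ᵥ x))
    (fun x hx h => decreasing x (mem_commonKer_succ.2
      ⟨hx, dotProduct_self_eq_zero.1 ((SF_form x hx).symm.trans h)⟩))).exists
  have S_symm : S.IsSymm := by simp [S, crossTerm, Matrix.IsSymm, add_comm]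
  refine ⟨P₁ - μ • S, symm.sub (S_symm.smul μ), pos.congr fun x hx => ?_,
    monotone.congr fun x hx => ?_, hμ.congr fun x _ => ?_⟩
  · rw [Matrix.sub_mulVec, dotProduct_sub, Matrix.smul_mulVec, dotProduct_smul,
      dotProduct_crossTerm_mulVec (ker x hx), smul_zero, sub_zero]
  · rw [sub_mul, smul_mul_assoc, Matrix.sub_mulVec, dotProduct_sub, Matrix.smul_mulVec,
      dotProduct_smul, SG_form x hx, smul_zero, sub_zero]
  · rw [sub_mul, smul_mul_assoc, neg_sub', sub_neg_eq_add]

theorem exists_isLyapunovOn {N : ℕ} (hN : commonKer M N = ⊥)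
    (hG : ∀ i, ∃ c > (0 : ℝ), M i * G = c • M i)
    (hF : ∀ i, ∃ c : ℝ, M i * F = M (i + 1) + c • M i) :
    ∃ P, IsLyapunovOn M G F 1 P := by
  have descend : ∀ j ≤ N, ∃ P, IsLyapunovOn M G F (N - j + 1) P := by
    intro j
    induction j with
    | zero =>
      refine fun _ => ⟨0, isLyapunovOn_zero_of_eq_bot (eq_bot_iff.2 fun x hx => ?_)⟩
      exact hN ▸ (mem_commonKer_succ.1 hx).1
    | succ j ih =>
      intro hj
      obtain ⟨P, hP⟩ := ih (Nat.le_of_succ_le hj)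
      rw [show N - j + 1 = N - (j + 1) + 2 by omega] at hP
      exact hP.exists_pred hG (hF _)
  simpa using descend N le_rfl

theorem exists_solvesLMI_of_commonKer_eq_bot {n k N : ℕ} {A₀ G : Matrix (Fin n) (Fin n) ℝ}
    {C : Matrix (Fin k) (Fin n) ℝ} (hN : commonKer (fun j => C * A₀ ^ j) N = ⊥)
    (hG : ∀ j, ∃ c > (0 : ℝ), C * A₀ ^ j * G = c • (C * A₀ ^ j)) (ρ : ℝ) :
    ∃ P Y, SolvesLMI A₀ C G ρ P Y := by
  have hF : ∀ j, ∃ c : ℝ, C * A₀ ^ j * (A₀ + ρ • G) = C * A₀ ^ (j + 1) + c • (C * A₀ ^ j) :=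
    fun j => by
      obtain ⟨c, -, hc⟩ := hG j
      exact ⟨ρ * c, by rw [Matrix.mul_add, Matrix.mul_smul, hc, smul_smul, pow_succ,
        Matrix.mul_assoc C]⟩
  obtain ⟨P₁, hP₁⟩ := exists_isLyapunovOn hN hG hF
  obtain ⟨P, symm, pos, monotone, decreasing⟩ := hP₁.exists_extend_pos (hG 0)
  have ker_zero : commonKer (fun j => C * A₀ ^ j) 0 = ⊤ := by simp [commonKer]
  obtain ⟨μ, hμ⟩ := (decreasing.eventually_add_smul_transpose_mul one_pos).exists
  rw [ker_zero] at pos monotone hμ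
  have symm' : Pᵀ = P := symm
  refine ⟨P, -μ • Cᵀ, ?_, ?_, pos.posDef symm⟩
  · convert hμ.posDef_add_transpose.posSemidef using 1
    simp only [pow_zero, Matrix.mul_one, one_smul, Matrix.transpose_add, Matrix.transpose_neg,
      Matrix.transpose_mul, Matrix.transpose_smul, Matrix.transpose_transpose, symm', mul_add,
      mul_smul_comm, Matrix.smul_mul, Matrix.mul_smul]
    module
  · simpa only [Matrix.transpose_mul, symm'] using monotone.posDef_add_transpose

theorem exists_solvesLMI {n k N : ℕ} {A G₀ : Matrix (Fin n) (Fin n) ℝ}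
    {C : Matrix (Fin k) (Fin n) ℝ} {Y₀ : Matrix (Fin n) (Fin k) ℝ}
    (h : (obsMatrix A C N).rank = n) (eqn : A * G₀ - G₀ * A + Y₀ * C = A) (eqnC : C * G₀ = 0)
    (hinv : IsUnit (1 + G₀)) {ν : ℝ} (hν : AntiHurwitz (genD G₀ ν)) (ρ : ℝ) :
    ∃ P Y, SolvesLMI (matA₀ A C G₀ Y₀) C (genD G₀ ν) ρ P Y := by
  refine exists_solvesLMI_of_commonKer_eq_bot (N := N) ?_ (fun j => ?_) ρ
  · exact eq_bot_iff.2 fun v hv =>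
      eq_zero_of_forall_mul_matA₀_pow_mulVec h (mem_commonKer.1 hv)
  · have eig := mul_matA₀_pow_mul_genD eqn eqnC hinv ν j
    by_cases hM : C * matA₀ A C G₀ Y₀ ^ j = 0
    · exact ⟨1, one_pos, by rw [hM, Matrix.zero_mul, smul_zero]⟩
    · exact ⟨_, hν.pos_of_mul_eq_smul eig hM, eig⟩

end LinearMatrixInequality

section QuadraticForm

variable {ι : Type*}

theorem transpose_eq_of_posDef {P : Matrix ι ι ℝ} (hP : P.PosDef) : Pᵀ = P := by
  simpa using hP.isHermitian.eq

variable [Fintype ι]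

theorem exists_dotProduct_mulVec_le (P : Matrix ι ι ℝ) {Q : Matrix ι ι ℝ} (hQ : Q.PosDef) :
    ∃ c > 0, ∀ x, x ⬝ᵥ P *ᵥ x ≤ c * (x ⬝ᵥ Q *ᵥ x) := by
  have pos : ∀ x, x ≠ 0 → 0 < x ⬝ᵥ Q *ᵥ x := fun x hx => by
    simpa using hQ.dotProduct_mulVec_pos hx
  obtain ⟨c, h, hc⟩ := ((eventually_posOn_add_smul (K := ⊤) (P := -P) (Q := Q)
    (fun x _ => by simpa using hQ.posSemidef.dotProduct_mulVec_nonneg x)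
    fun x _ hx hx0 => absurd hx (pos x hx0).ne').and (eventually_gt_atTop 0)).exists
  refine ⟨c, hc, fun x => ?_⟩
  rcases eq_or_ne x 0 with rfl | hx
  · simp
  · have := h x trivial hx
    rw [Matrix.add_mulVec, Matrix.neg_mulVec, Matrix.smul_mulVec, dotProduct_add, dotProduct_neg,
      dotProduct_smul, smul_eq_mul] at this
    linarith

theorem sq_norm_le_dotProduct_self (x : ι → ℝ) : ‖x‖ ^ 2 ≤ x ⬝ᵥ x := by
  have nonneg : 0 ≤ x ⬝ᵥ x := by simpa using dotProduct_star_self_nonneg x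
  rw [← Real.le_sqrt (norm_nonneg x) nonneg]
  refine (pi_norm_le_iff_of_nonneg (Real.sqrt_nonneg _)).2 fun i => Real.abs_le_sqrt ?_
  rw [sq]
  exact Finset.single_le_sum (f := fun i => x i * x i) (fun i _ => mul_self_nonneg _)
    (Finset.mem_univ i)

theorem dotProduct_self_le (x : ι → ℝ) : x ⬝ᵥ x ≤ Fintype.card ι * ‖x‖ ^ 2 := by
  rw [← nsmul_eq_mul, ← Finset.card_univ]
  refine Finset.sum_le_card_nsmul _ _ _ fun i _ => ?_
  rw [← sq, ← sq_abs]
  exact pow_le_pow_left₀ (abs_nonneg _) (norm_le_pi_norm x i) 2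

theorem exists_sq_norm_le {P : Matrix ι ι ℝ} (hP : P.PosDef) :
    ∃ c > 0, ∀ x : ι → ℝ, ‖x‖ ^ 2 ≤ c * (x ⬝ᵥ P *ᵥ x) := by
  classical
  obtain ⟨c, hc, h⟩ := exists_dotProduct_mulVec_le 1 hP
  refine ⟨c, hc, fun x => (sq_norm_le_dotProduct_self x).trans ?_⟩
  simpa using h x

theorem exists_le_sq_norm (P : Matrix ι ι ℝ) :
    ∃ c > 0, ∀ x : ι → ℝ, x ⬝ᵥ P *ᵥ x ≤ c * ‖x‖ ^ 2 := by
  classical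
  obtain ⟨c, hc, h⟩ := exists_dotProduct_mulVec_le P Matrix.PosDef.one
  refine ⟨c * (Fintype.card ι + 1), by positivity, fun x => (h x).trans ?_⟩
  rw [Matrix.one_mulVec, mul_assoc]
  gcongr
  linarith [dotProduct_self_le x, sq_nonneg ‖x‖]

theorem dotProduct_mul_add_transpose_mul_mulVec {P : Matrix ι ι ℝ} (hP : Pᵀ = P)
    (G : Matrix ι ι ℝ) (x : ι → ℝ) :
    x ⬝ᵥ (P * G + Gᵀ * P) *ᵥ x = 2 * (x ⬝ᵥ P *ᵥ (G *ᵥ x)) := by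
  rw [Matrix.mulVec_mulVec, ← dotProduct_add_transpose_mulVec, Matrix.transpose_mul, hP]

variable {f g : ℝ → ι → ℝ} {f' g' : ι → ℝ} {t : ℝ}

theorem hasDerivAt_dotProduct (hf : HasDerivAt f f' t) (hg : HasDerivAt g g' t) :
    HasDerivAt (fun t => f t ⬝ᵥ g t) (f' ⬝ᵥ g t + f t ⬝ᵥ g') t := by
  have h := HasDerivAt.fun_sum (u := Finset.univ) fun i _ =>
    (hasDerivAt_pi.1 hf i).mul (hasDerivAt_pi.1 hg i)
  rwa [Finset.sum_add_distrib] at h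

theorem hasDerivAt_mulVec {κ : Type*} [Finite κ] {M : ℝ → Matrix κ ι ℝ} {M' : Matrix κ ι ℝ}
    (hM : ∀ i j, HasDerivAt (fun t => M t i j) (M' i j) t) (hf : HasDerivAt f f' t) :
    HasDerivAt (fun t => M t *ᵥ f t) (M' *ᵥ f t + M t *ᵥ f') t := by
  cases nonempty_fintype κ
  exact hasDerivAt_pi.2 fun i => hasDerivAt_dotProduct (hasDerivAt_pi.2 (hM i)) hf

theorem hasDerivAt_quadraticForm {P : Matrix ι ι ℝ} (hP : Pᵀ = P) (hf : HasDerivAt f f' t) :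
    HasDerivAt (fun t => f t ⬝ᵥ P *ᵥ f t) (2 * (f t ⬝ᵥ P *ᵥ f')) t := by
  have h := hasDerivAt_dotProduct hf
    (hasDerivAt_mulVec (M' := 0) (fun i j => hasDerivAt_const t (P i j)) hf)
  rwa [Matrix.zero_mulVec, zero_add, Matrix.dotProduct_mulVec f', ← Matrix.mulVec_transpose, hP,
    dotProduct_comm (P *ᵥ f'), ← two_mul] at h

end QuadraticForm

section Dilation

variable {n : ℕ}

theorem expGroup_zero (G : Matrix (Fin n) (Fin n) ℝ) : expGroup G 0 = 1 := by
  rw [expGroup, zero_smul, NormedSpace.exp_zero]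

theorem expGroup_add (G : Matrix (Fin n) (Fin n) ℝ) (s t : ℝ) :
    expGroup G (s + t) = expGroup G s * expGroup G t := by
  rw [expGroup, add_smul]
  exact Matrix.exp_add_of_commute _ _ (((Commute.refl G).smul_left s).smul_right t)

theorem expGroup_neg_mulVec_expGroup_mulVec (G : Matrix (Fin n) (Fin n) ℝ) (s : ℝ)
    (x : Fin n → ℝ) : expGroup G (-s) *ᵥ (expGroup G s *ᵥ x) = x := by
  rw [Matrix.mulVec_mulVec, ← expGroup_add, neg_add_cancel, expGroup_zero, Matrix.one_mulVec]

open scoped Matrix.Norms.Operator in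
theorem hasDerivAt_expGroup_apply (G : Matrix (Fin n) (Fin n) ℝ) (s : ℝ) (i j : Fin n) :
    HasDerivAt (fun s => expGroup G s i j) ((G * expGroup G s) i j) s := by
  have h : HasDerivAt (fun u : ℝ => NormedSpace.exp (u • G)) (G * NormedSpace.exp (s • G)) s :=
    hasDerivAt_exp_smul_const' G s
  exact hasDerivAt_pi.1 (hasDerivAt_pi.1 h i) j

theorem hasDerivAt_expGroup_mulVec (G : Matrix (Fin n) (Fin n) ℝ) {σ : ℝ → ℝ} {σ' t : ℝ}
    {f : ℝ → Fin n → ℝ} {f' : Fin n → ℝ} (hσ : HasDerivAt σ σ' t) (hf : HasDerivAt f f' t) :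
    HasDerivAt (fun t => expGroup G (σ t) *ᵥ f t)
      (σ' • (G *ᵥ (expGroup G (σ t) *ᵥ f t)) + expGroup G (σ t) *ᵥ f') t := by
  have h := hasDerivAt_mulVec (M := fun t => expGroup G (σ t))
    (M' := σ' • (G * expGroup G (σ t)))
    (fun i j => by
      rw [Matrix.smul_apply, smul_eq_mul, mul_comm]
      exact (hasDerivAt_expGroup_apply G (σ t) i j).comp t hσ) hf
  rwa [Matrix.smul_mulVec, ← Matrix.mulVec_mulVec] at h

theorem continuous_expGroup (G : Matrix (Fin n) (Fin n) ℝ) : Continuous (expGroup G) :=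
  continuous_matrix fun i j => continuous_iff_continuousAt.2 fun s =>
    (hasDerivAt_expGroup_apply G s i j).continuousAt

theorem exists_monotone_exp_mul_quadraticForm {P G : Matrix (Fin n) (Fin n) ℝ} (hP : P.PosDef)
    (hPG : (P * G + Gᵀ * P).PosDef) : ∃ c > 0, ∀ x : Fin n → ℝ, Monotone fun s =>
      Real.exp (-c * s) * ((expGroup G s *ᵥ x) ⬝ᵥ P *ᵥ (expGroup G s *ᵥ x)) := by
  have symm := transpose_eq_of_posDef hP
  obtain ⟨a, ha, h⟩ := exists_dotProduct_mulVec_le P hPG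
  refine ⟨a⁻¹, inv_pos.2 ha, fun x => ?_⟩
  have deriv : ∀ s, HasDerivAt
      (fun s => Real.exp (-a⁻¹ * s) * ((expGroup G s *ᵥ x) ⬝ᵥ P *ᵥ (expGroup G s *ᵥ x))) _ s :=
    fun s => ((hasDerivAt_id s).const_mul (-a⁻¹)).exp.mul
      (hasDerivAt_quadraticForm symm
        (hasDerivAt_expGroup_mulVec G (hasDerivAt_id s) (hasDerivAt_const s x)))
  refine monotone_of_hasDerivAt_nonneg deriv fun s => ?_
  have bound := h (expGroup G s *ᵥ x)
  rw [dotProduct_mul_add_transpose_mul_mulVec symm, ← inv_mul_le_iff₀ ha] at bound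
  simp only [id, one_smul, mul_one, Matrix.mulVec_zero, add_zero, Pi.zero_apply]
  linarith [mul_le_mul_of_nonneg_left bound (Real.exp_nonneg (-a⁻¹ * s))]

theorem exists_norm_expGroup_mulVec_le {P G : Matrix (Fin n) (Fin n) ℝ} (hP : P.PosDef)
    (hPG : (P * G + Gᵀ * P).PosDef) : ∃ c > 0, ∃ b > 0, ∀ x : Fin n → ℝ, ∀ s ≤ 0,
      ‖expGroup G s *ᵥ x‖ ≤ b * Real.exp (c * s) * ‖x‖ := by
  obtain ⟨c, hc, mono⟩ := exists_monotone_exp_mul_quadraticForm hP hPG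
  obtain ⟨a, ha, lower⟩ := exists_sq_norm_le hP
  obtain ⟨b, hb, upper⟩ := exists_le_sq_norm P
  refine ⟨c / 2, half_pos hc, √(a * b), Real.sqrt_pos.2 (mul_pos ha hb), fun x s hs => ?_⟩
  refine le_of_sq_le_sq ?_ (by positivity)
  have decay := mono x hs
  simp only [mul_zero, Real.exp_zero, one_mul, expGroup_zero, Matrix.one_mulVec] at decay
  rw [neg_mul, Real.exp_neg, inv_mul_le_iff₀ (Real.exp_pos _)] at decay
  calc ‖expGroup G s *ᵥ x‖ ^ 2
      ≤ a * ((expGroup G s *ᵥ x) ⬝ᵥ P *ᵥ (expGroup G s *ᵥ x)) := lower _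
    _ ≤ a * (Real.exp (c * s) * (b * ‖x‖ ^ 2)) := by
      gcongr
      exact decay.trans (by gcongr; exact upper x)
    _ = (√(a * b) * Real.exp (c / 2 * s) * ‖x‖) ^ 2 := by
      rw [mul_pow, mul_pow, Real.sq_sqrt (by positivity), ← Real.exp_nat_mul]
      ring_nf

theorem isDilation_expGroup {P G : Matrix (Fin n) (Fin n) ℝ} (hP : P.PosDef)
    (hPG : (P * G + Gᵀ * P).PosDef) : IsDilation (expGroup G) where
  zero := expGroup_zero G
  add := expGroup_add G
  continuous := continuous_expGroup G
  expand x hx := by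
    obtain ⟨c, hc, b, hb, h⟩ := exists_norm_expGroup_mulVec_le hP hPG
    have bound : ∀ s ≥ 0, Real.exp (c * s) * (‖x‖ / b) ≤ ‖expGroup G s *ᵥ x‖ := fun s hs => by
      have := h (expGroup G s *ᵥ x) (-s) (neg_nonpos.2 hs)
      rw [expGroup_neg_mulVec_expGroup_mulVec, mul_neg, Real.exp_neg, mul_assoc,
        ← div_le_iff₀' hb] at this
      rwa [← le_inv_mul_iff₀ (Real.exp_pos _)]
    exact tendsto_atTop_mono' _ ((eventually_ge_atTop 0).mono bound)
      ((Real.tendsto_exp_atTop.comp (tendsto_id.const_mul_atTop hc)).atTop_mul_const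
        (div_pos (norm_pos_iff.2 hx) hb))
  contract x _ := by
    obtain ⟨c, hc, b, -, h⟩ := exists_norm_expGroup_mulVec_le hP hPG
    have lim : Tendsto (fun s => b * Real.exp (c * s) * ‖x‖) atBot (𝓝 0) := by
      simpa using ((Real.tendsto_exp_atBot.comp (tendsto_id.const_mul_atBot hc)).const_mul
        b).mul_const ‖x‖
    exact squeeze_zero' (.of_forall fun _ => norm_nonneg _) ((eventually_le_atBot 0).mono (h x)) lim

theorem extGroup_mulVec (G : Matrix (Fin n) (Fin n) ℝ) (s : ℝ) (e : Fin n ⊕ Unit → ℝ) :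
    extGroup G s *ᵥ e = Sum.elim (expGroup G s *ᵥ (e ∘ Sum.inl))
      (fun _ => Real.exp s * e (Sum.inr ())) := by
  rw [extGroup, Matrix.fromBlocks_mulVec]
  congr 1
  · simp
  · ext i
    simp [Matrix.smul_mulVec]

theorem norm_sumElim_unit (v : Fin n → ℝ) (r : ℝ) :
    ‖(Sum.elim v fun _ => r : Fin n ⊕ Unit → ℝ)‖ = max ‖v‖ |r| := by
  apply le_antisymm
  · refine (pi_norm_le_iff_of_nonneg (by positivity)).2 fun i => ?_
    rcases i with i | _
    · exact (norm_le_pi_norm v i).trans (le_max_left _ _)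
    · exact le_max_right _ _
  · refine max_le ((pi_norm_le_iff_of_nonneg (norm_nonneg _)).2 fun i => ?_) ?_
    · exact norm_le_pi_norm (Sum.elim v fun _ => r : Fin n ⊕ Unit → ℝ) (Sum.inl i)
    · exact norm_le_pi_norm (Sum.elim v fun _ => r : Fin n ⊕ Unit → ℝ) (Sum.inr ())

theorem isDilation_extGroup {G : Matrix (Fin n) (Fin n) ℝ} (h : IsDilation (expGroup G)) :
    IsDilation (extGroup G) where
  zero := by simp [extGroup, h.zero]
  add s t := by
    rw [extGroup, extGroup, extGroup, Matrix.fromBlocks_multiply, h.add, Real.exp_add]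
    simp [mul_smul, smul_comm (Real.exp s)]
  continuous := h.continuous.matrix_fromBlocks continuous_const continuous_const
    (Real.continuous_exp.smul continuous_const)
  expand e he := by
    simp only [extGroup_mulVec, norm_sumElim_unit]
    by_cases hε : e ∘ Sum.inl = 0
    · have hξ : e (Sum.inr ()) ≠ 0 := fun hξ => he <| by
        ext (i | _)
        · exact congrFun hε i
        · exact hξ
      refine tendsto_atTop_mono (fun s => le_max_right _ _) ?_
      simp only [abs_mul, Real.abs_exp]
      exact Real.tendsto_exp_atTop.atTop_mul_const (abs_pos.2 hξ)
    · exact tendsto_atTop_mono (fun s => le_max_left _ _) (h.expand _ hε)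
  contract e _ := by
    simp only [extGroup_mulVec, norm_sumElim_unit]
    have tendsto_inl : Tendsto (fun s => ‖expGroup G s *ᵥ (e ∘ Sum.inl)‖) atBot (𝓝 0) := by
      by_cases hε : e ∘ Sum.inl = 0
      · simp [hε]
      · exact h.contract _ hε
    have tendsto_inr : Tendsto (fun s => |Real.exp s * e (Sum.inr ())|) atBot (𝓝 0) := by
      simpa using (Real.tendsto_exp_atBot.mul_const (e (Sum.inr ()))).abs
    simpa using tendsto_inl.max tendsto_inr

end Dilation

section Homogeneity

variable {n k : ℕ} {A G : Matrix (Fin n) (Fin n) ℝ} {C : Matrix (Fin k) (Fin n) ℝ} {ν : ℝ}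

theorem expGroup_generator_zero (s : ℝ) : expGroup (0 : Matrix (Fin n) (Fin n) ℝ) s = 1 := by
  rw [expGroup, smul_zero, NormedSpace.exp_zero]

theorem expGroup_add_smul_one (G : Matrix (Fin n) (Fin n) ℝ) (c s : ℝ) :
    expGroup (G + c • 1) s = Real.exp (c * s) • expGroup G s := by
  have exp_scalar : NormedSpace.exp ((c * s) • (1 : Matrix (Fin n) (Fin n) ℝ)) =
      Real.exp (c * s) • 1 := by
    rw [← Matrix.diagonal_one, ← Matrix.diagonal_smul, Matrix.exp_diagonal, ← Matrix.diagonal_smul]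
    congr 1
    ext i
    simp [Pi.coe_exp, Real.exp_eq_exp_ℝ]
  rw [expGroup, smul_add, smul_smul, mul_comm s c, Matrix.exp_add_of_commute _ _
    ((Commute.one_right _).smul_right _), exp_scalar, Matrix.mul_smul, Matrix.mul_one, expGroup]

open scoped Matrix.Norms.Operator in
theorem mul_expGroup_of_mul_eq_mul {H : Matrix (Fin n) (Fin n) ℝ} (h : A * G = H * A) (s : ℝ) :
    A * expGroup G s = expGroup H s * A := by
  have semiconj : SemiconjBy A (s • G) (s • H) := by
    rw [SemiconjBy, Matrix.mul_smul, Matrix.smul_mul, h]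
  exact semiconj.exp_right

theorem mul_expGroup_of_mul_eq_add (h : A * G = (G + ν • 1) * A) (s : ℝ) :
    A * expGroup G s = Real.exp (ν * s) • (expGroup G s * A) := by
  rw [mul_expGroup_of_mul_eq_mul h, expGroup_add_smul_one, Matrix.smul_mul]

theorem mul_expGroup_of_mul_eq_self (h : C * G = C) (s : ℝ) :
    C * expGroup G s = Real.exp s • C := by
  -- The square matrix `Cᵀ * C` satisfies `(Cᵀ * C) * G = (0 + 1) * (Cᵀ * C)`, and `Cᵀ * C * X = 0`
  -- only if `C * X = 0`.
  have gram : Cᴴ * C * G = (0 + (1 : ℝ) • 1) * (Cᴴ * C) := by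
    rw [Matrix.mul_assoc, h, zero_add, one_smul, Matrix.one_mul]
  have exp_gram := mul_expGroup_of_mul_eq_mul gram s
  rw [expGroup_add_smul_one, one_mul, expGroup_generator_zero, Matrix.smul_mul, Matrix.one_mul,
    ← sub_eq_zero, ← Matrix.mul_one (Real.exp s • _), Matrix.smul_mul, ← Matrix.mul_smul,
    ← Matrix.mul_sub, Matrix.conjTranspose_mul_self_mul_eq_zero,
    Matrix.mul_sub, Matrix.mul_smul, Matrix.mul_one, sub_eq_zero] at exp_gram
  exact exp_gram

theorem gain_exp_mul (G : Matrix (Fin n) (Fin n) ℝ) (L : Matrix (Fin n) (Fin k) ℝ) (ν s : ℝ)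
    {ξ : ℝ} (hξ : ξ ≠ 0) :
    gain G L ν (Real.exp s * ξ) = Real.exp ((ν - 1) * s) • (expGroup G s * gain G L ν ξ) := by
  rw [gain, gain, abs_mul, Real.abs_exp,
    Real.log_mul (Real.exp_ne_zero _) (abs_ne_zero.2 hξ), Real.log_exp,
    Real.mul_rpow (Real.exp_nonneg _) (abs_nonneg _), ← Real.exp_mul, mul_comm s, expGroup_add,
    Matrix.mul_smul, mul_smul, Matrix.mul_assoc]

theorem gain_abs (G : Matrix (Fin n) (Fin n) ℝ) (L : Matrix (Fin n) (Fin k) ℝ) (ν ξ : ℝ) :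
    gain G L ν |ξ| = gain G L ν ξ := by
  rw [gain, abs_abs, gain]

theorem gain_one (G : Matrix (Fin n) (Fin n) ℝ) (L : Matrix (Fin n) (Fin k) ℝ) (ν : ℝ) :
    gain G L ν 1 = L := by
  rw [gain, abs_one, Real.one_rpow, Real.log_one, expGroup_zero, one_smul, Matrix.one_mul]

theorem xiField_of_ne_zero (ρ ν : ℝ) {ξ : ℝ} (hξ : ξ ≠ 0) :
    xiField ρ ν ξ = -ρ * |ξ| ^ ν * ξ := by
  rw [xiField, add_comm, Real.rpow_add_one (abs_ne_zero.2 hξ)]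
  rcases hξ.lt_or_gt with neg | pos
  · rw [Real.sign_of_neg neg, abs_of_neg neg]
    ring
  · rw [Real.sign_of_pos pos, abs_of_pos pos]
    ring

theorem xiField_exp_mul (ρ ν s : ℝ) {ξ : ℝ} (hξ : ξ ≠ 0) :
    xiField ρ ν (Real.exp s * ξ) = Real.exp (ν * s) * (Real.exp s * xiField ρ ν ξ) := by
  rw [xiField_of_ne_zero _ _ (mul_ne_zero (Real.exp_ne_zero s) hξ), xiField_of_ne_zero _ _ hξ,
    abs_mul, Real.abs_exp, Real.mul_rpow (Real.exp_nonneg _) (abs_nonneg _), ← Real.exp_mul,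
    mul_comm s]
  ring

theorem errorMatrix_mul_expGroup (hA : A * G = (G + ν • 1) * A) (hC : C * G = C)
    (L : Matrix (Fin n) (Fin k) ℝ) (s : ℝ) {ξ : ℝ} (hξ : ξ ≠ 0) :
    (A + gain G L ν (Real.exp s * ξ) * C) * expGroup G s =
      Real.exp (ν * s) • (expGroup G s * (A + gain G L ν ξ * C)) := by
  rw [gain_exp_mul G L ν s hξ, Matrix.add_mul, mul_expGroup_of_mul_eq_add hA, Matrix.mul_assoc,
    mul_expGroup_of_mul_eq_self hC, Matrix.smul_mul, Matrix.mul_smul, smul_smul, ← Real.exp_add,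
    Matrix.mul_add, smul_add, Matrix.mul_assoc]
  ring_nf

theorem errorField_eq (A : Matrix (Fin n) (Fin n) ℝ) (C : Matrix (Fin k) (Fin n) ℝ)
    (G : Matrix (Fin n) (Fin n) ℝ) (L : Matrix (Fin n) (Fin k) ℝ) (ρ ν : ℝ)
    (e : Fin n ⊕ Unit → ℝ) :
    errorField A C G L ρ ν e =
      Sum.elim ((A + gain G L ν (e (Sum.inr ())) * C) *ᵥ (e ∘ Sum.inl))
        fun _ => xiField ρ ν (e (Sum.inr ())) := by
  rw [Matrix.add_mulVec, ← Matrix.mulVec_mulVec]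
  rfl

theorem isHomogeneousOn_errorField (hA : A * G = (G + ν • 1) * A) (hC : C * G = C)
    (L : Matrix (Fin n) (Fin k) ℝ) (ρ : ℝ) :
    IsHomogeneousOn (extGroup G) (errorField A C G L ρ ν) ν {e | e (Sum.inr ()) ≠ 0} := by
  intro s e he
  refine ⟨?_, ?_⟩
  · rw [extGroup_mulVec]
    exact mul_ne_zero (Real.exp_ne_zero s) he
  · simp only [errorField_eq, extGroup_mulVec, Sum.elim_comp_inl, Sum.elim_inr,
      Matrix.mulVec_mulVec, errorMatrix_mul_expGroup hA hC L s he, Matrix.smul_mulVec,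
      xiField_exp_mul ρ ν s he]
    ext (i | _) <;> rfl

-- Homogeneity, applied between the points `1` and `|ξ|`.
theorem errorMatrix_mul_expGroup_log (hA : A * G = (G + ν • 1) * A) (hC : C * G = C)
    (L : Matrix (Fin n) (Fin k) ℝ) {ξ : ℝ} (hξ : ξ ≠ 0) :
    (A + gain G L ν ξ * C) * expGroup G (Real.log |ξ|) =
      |ξ| ^ ν • (expGroup G (Real.log |ξ|) * (A + L * C)) := by
  have h := errorMatrix_mul_expGroup hA hC L (Real.log |ξ|) one_ne_zero
  rwa [mul_one, gain_one, Real.exp_log (abs_pos.2 hξ), gain_abs, mul_comm ν,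
    ← Real.rpow_def_of_pos (abs_pos.2 hξ)] at h

theorem continuousOn_gain (G : Matrix (Fin n) (Fin n) ℝ) (L : Matrix (Fin n) (Fin k) ℝ) (ν : ℝ)
    {ξ : ℝ → ℝ} {S : Set ℝ} (hξ : ContinuousOn ξ S) (h0 : ∀ t ∈ S, ξ t ≠ 0) :
    ContinuousOn (fun t => gain G L ν (ξ t)) S := by
  have h0' : ∀ t ∈ S, |ξ t| ≠ 0 := fun t ht => abs_ne_zero.2 (h0 t ht)
  exact (hξ.abs.rpow_const fun t ht => Or.inl (h0' t ht)).smul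
    (((continuous_expGroup G).matrix_mul continuous_const).comp_continuousOn (hξ.abs.log h0'))

end Homogeneity

section Solutions

variable {E : Type*} [NormedAddCommGroup E] [NormedSpace ℝ E] {J : Set ℝ} {f g : ℝ → E → E}
  {w : ℝ → E}

/-- `J` is an interval of nonnegative times that contains `[0, t]` along with each `t`: the time
axis, up to some right end point, on which solutions starting at `0` are considered. -/
def IsTimeInterval (J : Set ℝ) : Prop :=
  ∀ t ∈ J, 0 ≤ t ∧ Set.Icc 0 t ⊆ J

theorem IsTimeInterval.uIcc_subset (hJ : IsTimeInterval J) {t : ℝ} (ht : t ∈ J) :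
    Set.uIcc 0 t ⊆ J := by
  rw [Set.uIcc_of_le (hJ t ht).1]
  exact (hJ t ht).2

theorem IsSolutionOn.congr_field (h : IsSolutionOn J f w) (hJ : IsTimeInterval J)
    (hfg : ∀ t ∈ J, ∀ v, f t v = g t v) : IsSolutionOn J g w := by
  intro t ht
  have eqOn : Set.EqOn (fun s => f s (w s)) (fun s => g s (w s)) (Set.uIcc 0 t) := fun s hs =>
    hfg s (hJ.uIcc_subset ht hs) (w s)
  rw [← intervalIntegral.integral_congr eqOn]
  exact ⟨(h t ht).1.congr (eqOn.mono Set.uIoc_subset_uIcc), (h t ht).2⟩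

theorem IsSolutionOn.sub_iff {x z : ℝ → E} {e : ℝ → E → E} (hx : IsSolutionOn J f x)
    (he : ∀ t, g t (z t) - f t (x t) = e t (z t - x t)) :
    IsSolutionOn J e (fun t => z t - x t) ↔ IsSolutionOn J g z := by
  simp only [IsSolutionOn, ← he]
  refine forall₂_congr fun t ht => ?_
  obtain ⟨x_int, x_eq⟩ := hx t ht
  constructor
  · rintro ⟨e_int, e_eq⟩
    have z_int : IntervalIntegrable (fun s => g s (z s)) volume 0 t := by
      simpa only [sub_add_cancel] using e_int.add x_int
    refine ⟨z_int, ?_⟩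
    rw [intervalIntegral.integral_sub z_int x_int] at e_eq
    rw [← sub_add_cancel (z t) (x t), e_eq, x_eq]
    abel
  · rintro ⟨z_int, z_eq⟩
    refine ⟨z_int.sub x_int, ?_⟩
    rw [intervalIntegral.integral_sub z_int x_int, z_eq, x_eq]
    abel

theorem IsSolutionOn.continuousOn (h : IsSolutionOn J f w) (hJ : IsTimeInterval J) {T : ℝ}
    (hT : T ∈ J) : ContinuousOn w (Set.Icc 0 T) := by
  have primitive := intervalIntegral.continuousOn_primitive_interval' (h T hT).1 Set.left_mem_uIcc
  rw [Set.uIcc_of_le (hJ T hT).1] at primitive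
  exact (continuousOn_const.add primitive).congr fun t ht => (h t ((hJ T hT).2 ht)).2

theorem isSolutionOn_of_hasDerivAt [CompleteSpace E] (hJ : IsTimeInterval J)
    (hw : ∀ t ∈ J, HasDerivAt w (f t (w t)) t) (hf : ContinuousOn (fun t => f t (w t)) J) :
    IsSolutionOn J f w := by
  intro t ht
  have integrable : IntervalIntegrable (fun s => f s (w s)) volume 0 t :=
    (hf.mono (hJ.uIcc_subset ht)).intervalIntegrable
  refine ⟨integrable, ?_⟩
  rw [intervalIntegral.integral_eq_sub_of_hasDerivAt
    (fun s hs => hw s (hJ.uIcc_subset ht hs)) integrable, add_sub_cancel]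

theorem IsSolutionOn.hasDerivAt [CompleteSpace E] (h : IsSolutionOn J f w)
    (hJ : IsTimeInterval J) {T : ℝ} (hT : T ∈ J)
    (hf : ContinuousOn (fun t => f t (w t)) (Set.Icc 0 T)) {t : ℝ} (ht : t ∈ Set.Ioo 0 T) :
    HasDerivAt w (f t (w t)) t := by
  have hf' : ContinuousOn (fun t => f t (w t)) (Set.Ioo 0 T) := hf.mono Set.Ioo_subset_Icc_self
  refine ((intervalIntegral.integral_hasDerivAt_right
    (h t ((hJ T hT).2 ⟨ht.1.le, ht.2.le⟩)).1 (hf'.stronglyMeasurableAtFilter isOpen_Ioo t ht)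
    (hf'.continuousAt (isOpen_Ioo.mem_nhds ht))).const_add (w 0)).congr_of_eventuallyEq ?_
  filter_upwards [isOpen_Ioo.mem_nhds ht] with s hs
  exact (h s ((hJ T hT).2 ⟨hs.1.le, hs.2.le⟩)).2

theorem IsSolutionOn.hasDerivWithinAt_Ici [CompleteSpace E] (h : IsSolutionOn J f w)
    (hJ : IsTimeInterval J) {a b : ℝ} (ha : 0 ≤ a) (hb : b ∈ J)
    (hf : ContinuousOn (fun t => f t (w t)) (Set.Icc a b)) {t : ℝ} (ht : t ∈ Set.Ico a b) :
    HasDerivWithinAt w (f t (w t)) (Set.Ici t) t := by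
  have mem_nhdsGT : Set.Icc a b ∈ 𝓝[>] t :=
    mem_of_superset (Ioo_mem_nhdsGT ht.2) fun s hs => ⟨ht.1.trans hs.1.le, hs.2.le⟩
  have mem_nhdsGE : Set.Ico t b ∈ 𝓝[≥] t := Ico_mem_nhdsGE ht.2
  have eq : ∀ s ∈ Set.Ico t b, w s = w 0 + ∫ r in (0 : ℝ)..s, f r (w r) := fun s hs =>
    (h s ((hJ b hb).2 ⟨ha.trans (ht.1.trans hs.1), hs.2.le⟩)).2
  refine ((intervalIntegral.integral_hasDerivWithinAt_right (s := Set.Ici t) (t := Set.Ioi t)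
    (h t ((hJ b hb).2 ⟨ha.trans ht.1, ht.2.le⟩)).1
    ⟨Set.Icc a b, mem_nhdsGT, hf.aestronglyMeasurable measurableSet_Icc⟩
    ((hf t ⟨ht.1, ht.2.le⟩).mono_of_mem_nhdsWithin mem_nhdsGT)).const_add
    (w 0)).congr_of_eventuallyEq (mem_of_superset mem_nhdsGE eq) ?_
  exact eq t ⟨le_rfl, ht.2⟩

theorem IsSolutionOn.eventually_eq_nhdsGT [CompleteSpace E] {f : E → E} {x y : ℝ → E}
    (hJ : IsTimeInterval J) (hx : IsSolutionOn J (fun _ => f) x)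
    (hy : IsSolutionOn J (fun _ => f) y) {t T : ℝ} (ht : t ∈ Set.Ico 0 T) (hT : T ∈ J)
    (hxy : x t = y t) {K : NNReal} {U : Set E} (hU : U ∈ 𝓝 (y t)) (hf : LipschitzOnWith K f U) :
    ∀ᶠ s in 𝓝[>] t, x s = y s := by
  have stay : ∀ {z : ℝ → E}, IsSolutionOn J (fun _ => f) z → z t = y t →
      ∀ᶠ s in 𝓝[≥] t, z s ∈ U := fun hz hzy =>
    ((hz.continuousOn hJ hT t ⟨ht.1, ht.2.le⟩).mono_of_mem_nhdsWithin
      (mem_of_superset (Icc_mem_nhdsGE ht.2) (Set.Icc_subset_Icc_left ht.1))).eventually_mem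
      (by rwa [hzy])
  obtain ⟨b, htb : t < b, hb⟩ := mem_nhdsGE_iff_exists_Icc_subset.1
    (inter_mem ((stay hx hxy).and (stay hy rfl)) (Ico_mem_nhdsGE ht.2))
  have hbJ : b ∈ J := (hJ T hT).2 ⟨ht.1.trans htb.le, (hb ⟨htb.le, le_rfl⟩).2.2.le⟩
  have cont : ∀ {z : ℝ → E}, IsSolutionOn J (fun _ => f) z → ContinuousOn z (Set.Icc t b) :=
    fun hz => (hz.continuousOn hJ hbJ).mono (Set.Icc_subset_Icc_left ht.1)
  have eqOn : Set.EqOn x y (Set.Icc t b) :=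
    ODE_solution_unique_of_mem_Icc_right (v := fun _ => f) (s := fun _ => U) (fun _ _ => hf)
      (cont hx) (fun s => hx.hasDerivWithinAt_Ici hJ ht.1 hbJ
        (hf.continuousOn.comp (cont hx) fun r hr => (hb hr).1.1))
      (fun s hs => (hb (Set.Ico_subset_Icc_self hs)).1.1)
      (cont hy) (fun s => hy.hasDerivWithinAt_Ici hJ ht.1 hbJ
        (hf.continuousOn.comp (cont hy) fun r hr => (hb hr).1.2))
      (fun s hs => (hb (Set.Ico_subset_Icc_self hs)).1.2) hxy
  exact mem_of_superset (Ioo_mem_nhdsGT htb) fun s hs => eqOn (Set.Ioo_subset_Icc_self hs)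

theorem IsSolutionOn.eqOn_of_locally_lipschitz [CompleteSpace E] {f : E → E} {x y : ℝ → E}
    (hJ : IsTimeInterval J) (hx : IsSolutionOn J (fun _ => f) x)
    (hy : IsSolutionOn J (fun _ => f) y) (hxy : x 0 = y 0)
    (hf : ∀ t ∈ J, ∃ K, ∃ U ∈ 𝓝 (y t), LipschitzOnWith K f U) : Set.EqOn x y J := by
  intro T hT
  have closed : IsClosed ({t | x t = y t} ∩ Set.Icc 0 T) := by
    rw [Set.inter_comm]
    exact ((hx.continuousOn hJ hT).prodMk (hy.continuousOn hJ hT)).preimage_isClosed_of_isClosed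
      isClosed_Icc isClosed_diagonal
  refine closed.Icc_subset_of_forall_mem_nhdsWithin hxy (fun t ⟨hxyt, ht⟩ => ?_)
    (Set.right_mem_Icc.2 (hJ T hT).1)
  obtain ⟨K, U, hU, hfU⟩ := hf t ((hJ T hT).2 (Set.Ico_subset_Icc_self ht))
  exact hx.eventually_eq_nhdsGT hJ hy ht hT hxyt hU hfU

end Solutions

section ScalarEquation

variable {ρ ν ξ₀ t : ℝ}

theorem isTimeInterval_horizon (ρ ν ξ₀ : ℝ) : IsTimeInterval (horizon ρ ν ξ₀) := by
  intro t ht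
  rw [horizon] at ht ⊢
  split_ifs at ht ⊢
  · exact ⟨ht.1, fun s hs => ⟨hs.1, hs.2.trans_lt ht.2⟩⟩
  · exact ⟨ht, fun s hs => hs.1⟩

theorem zero_mem_horizon (hρ : 0 < ρ) (hξ₀ : ξ₀ ≠ 0) : 0 ∈ horizon ρ ν ξ₀ := by
  rw [horizon]
  split_ifs with hν
  · exact ⟨le_rfl, div_pos (Real.rpow_pos_of_pos (abs_pos.2 hξ₀) _) (mul_pos (neg_pos.2 hν) hρ)⟩
  · exact Set.self_mem_Ici

theorem eventually_mem_horizon (hρ : 0 < ρ) (hξ₀ : ξ₀ ≠ 0) :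
    ∀ᶠ t in toHorizon ρ ν ξ₀, t ∈ horizon ρ ν ξ₀ := by
  have zero_mem := zero_mem_horizon (ν := ν) hρ hξ₀
  rw [horizon] at zero_mem ⊢
  rw [toHorizon]
  split_ifs at zero_mem ⊢
  · exact Ico_mem_nhdsLT zero_mem.2
  · exact eventually_ge_atTop 0

/-- The solution of `ξ' = xiField ρ ν ξ` with `ξ 0 = ξ₀`: the Bernoulli equation
`ξ' = -ρ |ξ|^ν ξ` is linear in `|ξ|^(-ν)` for `ν ≠ 0`. -/
noncomputable def xiFlow (ρ ν ξ₀ t : ℝ) : ℝ :=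
  if ν = 0 then ξ₀ * Real.exp (-ρ * t) else ξ₀ * (1 + ν * ρ * |ξ₀| ^ ν * t) ^ (-1 / ν)

theorem xiFlow_degree_zero (ρ ξ₀ : ℝ) : xiFlow ρ 0 ξ₀ = fun t => ξ₀ * Real.exp (-ρ * t) :=
  funext fun _ => if_pos rfl

theorem xiFlow_of_ne_zero (ρ : ℝ) (hν : ν ≠ 0) (ξ₀ : ℝ) :
    xiFlow ρ ν ξ₀ = fun t => ξ₀ * (1 + ν * ρ * |ξ₀| ^ ν * t) ^ (-1 / ν) :=
  funext fun _ => if_neg hν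

theorem xiFlow_zero (ρ ν ξ₀ : ℝ) : xiFlow ρ ν ξ₀ 0 = ξ₀ := by
  rw [xiFlow]
  split_ifs <;> simp

theorem one_add_mul_pos_of_mem_horizon (hρ : 0 < ρ) (hξ₀ : ξ₀ ≠ 0) (ht : t ∈ horizon ρ ν ξ₀) :
    0 < 1 + ν * ρ * |ξ₀| ^ ν * t := by
  have pos : 0 < |ξ₀| ^ ν := Real.rpow_pos_of_pos (abs_pos.2 hξ₀) _
  rw [horizon] at ht
  split_ifs at ht with hν
  · have := ht.2
    rw [settlingTime, Real.rpow_neg (abs_nonneg _), lt_div_iff₀ (mul_pos (neg_pos.2 hν) hρ),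
      ← one_div, lt_div_iff₀ pos] at this
    linarith
  · have := mul_nonneg (mul_nonneg (mul_nonneg (not_lt.1 hν) hρ.le) pos.le) ht
    linarith

theorem xiFlow_ne_zero (hρ : 0 < ρ) (hξ₀ : ξ₀ ≠ 0) (ht : t ∈ horizon ρ ν ξ₀) :
    xiFlow ρ ν ξ₀ t ≠ 0 := by
  rw [xiFlow]
  split_ifs
  · exact mul_ne_zero hξ₀ (Real.exp_ne_zero _)
  · exact mul_ne_zero hξ₀
      (Real.rpow_pos_of_pos (one_add_mul_pos_of_mem_horizon hρ hξ₀ ht) _).ne'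

theorem hasDerivAt_xiFlow (hρ : 0 < ρ) (hξ₀ : ξ₀ ≠ 0) (ht : t ∈ horizon ρ ν ξ₀) :
    HasDerivAt (xiFlow ρ ν ξ₀) (xiField ρ ν (xiFlow ρ ν ξ₀ t)) t := by
  rw [xiField_of_ne_zero _ _ (xiFlow_ne_zero hρ hξ₀ ht)]
  rcases eq_or_ne ν 0 with rfl | hν
  · rw [xiFlow_degree_zero]
    refine (((hasDerivAt_id' t).const_mul (-ρ)).exp.const_mul ξ₀).congr_deriv ?_
    rw [Real.rpow_zero]
    ring
  · have pos := one_add_mul_pos_of_mem_horizon hρ hξ₀ ht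
    rw [xiFlow_of_ne_zero ρ hν]
    refine ((((hasDerivAt_id' t).const_mul (ν * ρ * |ξ₀| ^ ν)).const_add 1).rpow_const
      (p := -1 / ν) (Or.inl pos.ne')).const_mul ξ₀ |>.congr_deriv ?_
    rw [abs_mul, abs_of_pos (Real.rpow_pos_of_pos pos _),
      Real.mul_rpow (abs_nonneg _) (Real.rpow_nonneg pos.le _), ← Real.rpow_mul pos.le,
      div_mul_cancel₀ _ hν, Real.rpow_neg_one, Real.rpow_sub_one pos.ne']
    field_simp

theorem tendsto_xiFlow_of_neg (hρ : 0 < ρ) (hν : ν < 0) (hξ₀ : ξ₀ ≠ 0) :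
    Tendsto (xiFlow ρ ν ξ₀) (𝓝 (settlingTime ρ ν ξ₀)) (𝓝 0) := by
  have base : 1 + ν * ρ * |ξ₀| ^ ν * settlingTime ρ ν ξ₀ = 0 := by
    rw [settlingTime, Real.rpow_neg (abs_nonneg _)]
    have hν' : ν ≠ 0 := hν.ne
    have := (Real.rpow_pos_of_pos (abs_pos.2 hξ₀) ν).ne'
    field_simp
    ring
  have exponent : 0 < -1 / ν := div_pos_of_neg_of_neg (by norm_num) hν
  have cont : ContinuousAt (fun t => ξ₀ * (1 + ν * ρ * |ξ₀| ^ ν * t) ^ (-1 / ν))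
      (settlingTime ρ ν ξ₀) :=
    continuousAt_const.mul (ContinuousAt.rpow_const (by fun_prop) (Or.inr exponent.le))
  rw [xiFlow_of_ne_zero ρ hν.ne]
  simpa only [base, Real.zero_rpow exponent.ne', mul_zero] using cont.tendsto

theorem tendsto_xiFlow_of_nonneg (hρ : 0 < ρ) (hν : 0 ≤ ν) (hξ₀ : ξ₀ ≠ 0) :
    Tendsto (xiFlow ρ ν ξ₀) atTop (𝓝 0) := by
  rw [← mul_zero ξ₀]
  rcases hν.eq_or_lt' with rfl | hν
  · rw [xiFlow_degree_zero]
    exact (Real.tendsto_exp_atBot.comp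
      (tendsto_id.const_mul_atTop_of_neg (neg_neg_of_pos hρ))).const_mul ξ₀
  · have rate : 0 < ν * ρ * |ξ₀| ^ ν :=
      mul_pos (mul_pos hν hρ) (Real.rpow_pos_of_pos (abs_pos.2 hξ₀) _)
    rw [xiFlow_of_ne_zero ρ hν.ne', neg_div]
    exact ((tendsto_rpow_neg_atTop (one_div_pos.2 hν)).comp
      (tendsto_atTop_add_const_left _ _ (tendsto_id.const_mul_atTop rate))).const_mul ξ₀

theorem tendsto_xiFlow (hρ : 0 < ρ) (hξ₀ : ξ₀ ≠ 0) :
    Tendsto (xiFlow ρ ν ξ₀) (toHorizon ρ ν ξ₀) (𝓝 0) := by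
  rw [toHorizon]
  split_ifs with hν
  · exact (tendsto_xiFlow_of_neg hρ hν hξ₀).mono_left nhdsWithin_le_nhds
  · exact tendsto_xiFlow_of_nonneg hρ (not_lt.1 hν) hξ₀

theorem contDiffAt_xiField (ρ ν : ℝ) {ξ : ℝ} (hξ : ξ ≠ 0) : ContDiffAt ℝ 1 (xiField ρ ν) ξ := by
  refine ContDiffAt.congr_of_eventuallyEq ?_ ((eventually_ne_nhds hξ).mono fun _ =>
    xiField_of_ne_zero ρ ν)
  exact ((contDiffAt_const (c := -ρ)).mul
    ((contDiffAt_abs hξ).rpow_const_of_ne (abs_ne_zero.2 hξ))).mul contDiffAt_id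

theorem isSolutionOn_xiFlow (hρ : 0 < ρ) (hξ₀ : ξ₀ ≠ 0) :
    IsSolutionOn (horizon ρ ν ξ₀) (fun _ => xiField ρ ν) (xiFlow ρ ν ξ₀) :=
  isSolutionOn_of_hasDerivAt (isTimeInterval_horizon ρ ν ξ₀)
    (fun _ ht => hasDerivAt_xiFlow hρ hξ₀ ht) fun _ ht =>
      ((contDiffAt_xiField ρ ν (xiFlow_ne_zero hρ hξ₀ ht)).continuousAt.comp
        (hasDerivAt_xiFlow hρ hξ₀ ht).continuousAt).continuousWithinAt

theorem IsSolutionOn.eqOn_xiFlow {ξ : ℝ → ℝ}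
    (hξ : IsSolutionOn (horizon ρ ν ξ₀) (fun _ => xiField ρ ν) ξ) (h0 : ξ 0 = ξ₀) (hρ : 0 < ρ)
    (hξ₀ : ξ₀ ≠ 0) : Set.EqOn ξ (xiFlow ρ ν ξ₀) (horizon ρ ν ξ₀) :=
  hξ.eqOn_of_locally_lipschitz (isTimeInterval_horizon ρ ν ξ₀) (isSolutionOn_xiFlow hρ hξ₀)
    (by rw [h0, xiFlow_zero]) fun _ ht =>
      (contDiffAt_xiField ρ ν (xiFlow_ne_zero hρ hξ₀ ht)).exists_lipschitzOnWith

end ScalarEquation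

section ErrorEquation

variable {n k : ℕ} {A G P : Matrix (Fin n) (Fin n) ℝ} {C : Matrix (Fin k) (Fin n) ℝ}
  {L Y : Matrix (Fin n) (Fin k) ℝ} {ρ ν : ℝ} {J : Set ℝ} {ξ : ℝ → ℝ} {ε w : ℝ → Fin n → ℝ} {t : ℝ}

theorem hasDerivAt_log_abs_of_xiField (hξ : HasDerivAt ξ (xiField ρ ν (ξ t)) t) (h0 : ξ t ≠ 0) :
    HasDerivAt (fun t => Real.log |ξ t|) (-ρ * |ξ t| ^ ν) t := by
  simp only [Real.log_abs]
  refine (hξ.log h0).congr_deriv ?_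
  rw [xiField_of_ne_zero ρ ν h0, mul_div_cancel_right₀ _ h0]

-- The substitution `ε = d(ln |ξ|) w` turns the error equation into the equation
-- `w' = |ξ|^ν (A + L C + ρ G) w`, a time-scaled linear system with constant coefficients.
theorem hasDerivAt_expGroup_log_mulVec (hA : A * G = (G + ν • 1) * A) (hC : C * G = C)
    (hξ : HasDerivAt ξ (xiField ρ ν (ξ t)) t) (h0 : ξ t ≠ 0)
    (hw : HasDerivAt w (|ξ t| ^ ν • ((A + L * C + ρ • G) *ᵥ w t)) t) :
    HasDerivAt (fun t => expGroup G (Real.log |ξ t|) *ᵥ w t)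
      ((A + gain G L ν (ξ t) * C) *ᵥ (expGroup G (Real.log |ξ t|) *ᵥ w t)) t := by
  refine (hasDerivAt_expGroup_mulVec G (hasDerivAt_log_abs_of_xiField hξ h0) hw).congr_deriv ?_
  rw [mulVec_mulVec _ (A + gain G L ν (ξ t) * C), errorMatrix_mul_expGroup_log hA hC L h0,
    mulVec_mulVec _ G, mul_expGroup_of_mul_eq_mul rfl, ← mulVec_mulVec, add_mulVec, smul_mulVec,
    smul_mulVec, ← mulVec_mulVec, mulVec_smul, mulVec_add, mulVec_smul]
  module

theorem hasDerivAt_expGroup_neg_log_mulVec (hA : A * G = (G + ν • 1) * A) (hC : C * G = C)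
    (hξ : HasDerivAt ξ (xiField ρ ν (ξ t)) t) (h0 : ξ t ≠ 0)
    (hε : HasDerivAt ε ((A + gain G L ν (ξ t) * C) *ᵥ ε t) t) :
    HasDerivAt (fun t => expGroup G (-Real.log |ξ t|) *ᵥ ε t)
      (|ξ t| ^ ν • ((A + L * C + ρ • G) *ᵥ (expGroup G (-Real.log |ξ t|) *ᵥ ε t))) t := by
  refine (hasDerivAt_expGroup_mulVec G
    (hasDerivAt_log_abs_of_xiField hξ h0).fun_neg hε).congr_deriv ?_
  obtain ⟨v, hv⟩ : ∃ v, ε t = expGroup G (Real.log |ξ t|) *ᵥ v :=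
    ⟨_, by simpa only [neg_neg] using
      (expGroup_neg_mulVec_expGroup_mulVec G (-Real.log |ξ t|) (ε t)).symm⟩
  rw [hv, mulVec_mulVec _ (A + gain G L ν (ξ t) * C), errorMatrix_mul_expGroup_log hA hC L h0,
    smul_mulVec, ← mulVec_mulVec, mulVec_smul, expGroup_neg_mulVec_expGroup_mulVec,
    expGroup_neg_mulVec_expGroup_mulVec, add_mulVec _ (ρ • G), smul_mulVec]
  module

theorem continuousOn_errorMatrix_mulVec {S : Set ℝ} (hξ : ContinuousOn ξ S)
    (h0 : ∀ t ∈ S, ξ t ≠ 0) (hε : ContinuousOn ε S) :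
    ContinuousOn (fun t => (A + gain G L ν (ξ t) * C) *ᵥ ε t) S :=
  (Continuous.matrix_mulVec continuous_fst continuous_snd).comp_continuousOn
    ((continuousOn_const.add ((Continuous.matrix_mul continuous_id
      continuous_const).comp_continuousOn (continuousOn_gain G L ν hξ h0))).prodMk hε)

theorem exists_isSolutionOn_error (hA : A * G = (G + ν • 1) * A) (hC : C * G = C)
    (L : Matrix (Fin n) (Fin k) ℝ) (hρ : ρ ≠ 0) (hJ : IsTimeInterval J)
    (hξ : ∀ t ∈ J, HasDerivAt ξ (xiField ρ ν (ξ t)) t) (h0 : ∀ t ∈ J, ξ t ≠ 0)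
    (ε₀ : Fin n → ℝ) :
    ∃ ε, ε 0 = ε₀ ∧ IsSolutionOn J (fun t v => (A + gain G L ν (ξ t) * C) *ᵥ v) ε := by
  set w : ℝ → Fin n → ℝ := fun t =>
    expGroup (A + L * C + ρ • G) ((Real.log |ξ 0| - Real.log |ξ t|) / ρ) *ᵥ
      (expGroup G (-Real.log |ξ 0|) *ᵥ ε₀) with w_def
  have hw : ∀ t ∈ J, HasDerivAt w (|ξ t| ^ ν • ((A + L * C + ρ • G) *ᵥ w t)) t := fun t ht => by
    refine (hasDerivAt_expGroup_mulVec (A + L * C + ρ • G)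
      (((hasDerivAt_log_abs_of_xiField (hξ t ht) (h0 t ht)).const_sub
        (Real.log |ξ 0|)).div_const ρ) (hasDerivAt_const t _)).congr_deriv ?_
    rw [mulVec_zero, add_zero, neg_mul, neg_neg, mul_div_cancel_left₀ _ hρ]
  have hε := fun t ht => hasDerivAt_expGroup_log_mulVec hA hC (hξ t ht) (h0 t ht) (hw t ht)
  refine ⟨fun t => expGroup G (Real.log |ξ t|) *ᵥ w t, ?_, isSolutionOn_of_hasDerivAt hJ hε ?_⟩
  · simp only [w_def, sub_self, zero_div, expGroup_zero, one_mulVec]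
    simpa only [neg_neg] using expGroup_neg_mulVec_expGroup_mulVec G (-Real.log |ξ 0|) ε₀
  · exact continuousOn_errorMatrix_mulVec (fun t ht => (hξ t ht).continuousAt.continuousWithinAt) h0
      fun t ht => (hε t ht).continuousAt.continuousWithinAt

theorem SolvesLMI.closedLoop_nonpos (h : SolvesLMI A C G ρ P Y) (x : Fin n → ℝ) :
    x ⬝ᵥ P *ᵥ ((A + P⁻¹ * Y * C + ρ • G) *ᵥ x) ≤ 0 := by
  have symm := transpose_eq_of_posDef h.posDef
  have gain_mul : P * (P⁻¹ * Y * C) = Y * C := by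
    rw [Matrix.mul_assoc, mul_nonsing_inv_cancel_left _ _
      ((isUnit_iff_isUnit_det _).1 h.posDef.isUnit)]
  have transpose_gain_mul : (P⁻¹ * Y * C)ᵀ * P = Cᵀ * Yᵀ := by
    rw [← transpose_mul Y C, ← gain_mul, transpose_mul P, symm]
  have lyapunov : P * A + Aᵀ * P + Y * C + Cᵀ * Yᵀ + ρ • (P * G + Gᵀ * P) =
      P * (A + P⁻¹ * Y * C + ρ • G) + (A + P⁻¹ * Y * C + ρ • G)ᵀ * P := by
    rw [mul_add, mul_add, gain_mul, transpose_add, transpose_add, add_mul, add_mul,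
      transpose_gain_mul, transpose_smul, mul_smul_comm, smul_mul_assoc, smul_add]
    abel
  have nonneg := h.lmi.dotProduct_mulVec_nonneg x
  rw [lyapunov, neg_mulVec, dotProduct_neg, star_trivial,
    dotProduct_mul_add_transpose_mul_mulVec symm] at nonneg
  linarith

theorem SolvesLMI.quadraticForm_error_le (h : SolvesLMI A C G ρ P Y)
    (hA : A * G = (G + ν • 1) * A) (hC : C * G = C) (hJ : IsTimeInterval J)
    (hξ : ∀ t ∈ J, HasDerivAt ξ (xiField ρ ν (ξ t)) t) (h0 : ∀ t ∈ J, ξ t ≠ 0)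
    (hε : IsSolutionOn J (fun t v => (A + gain G (P⁻¹ * Y) ν (ξ t) * C) *ᵥ v) ε) (ht : t ∈ J)
    (hw : ∀ s, w s = expGroup G (-Real.log |ξ s|) *ᵥ ε s) :
    w t ⬝ᵥ P *ᵥ w t ≤ w 0 ⬝ᵥ P *ᵥ w 0 := by
  obtain rfl : w = fun s => expGroup G (-Real.log |ξ s|) *ᵥ ε s := funext hw
  have hJt := (hJ t ht).2
  have ξ_cont : ContinuousOn ξ (Set.Icc 0 t) := fun s hs =>
    (hξ s (hJt hs)).continuousAt.continuousWithinAt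
  have h0' : ∀ s ∈ Set.Icc 0 t, ξ s ≠ 0 := fun s hs => h0 s (hJt hs)
  have ε_cont := hε.continuousOn hJ ht
  have deriv_w : ∀ s ∈ Set.Ioo 0 t, _ := fun s hs =>
    have hs' := hJt (Set.Ioo_subset_Icc_self hs)
    hasDerivAt_expGroup_neg_log_mulVec hA hC (hξ s hs') (h0 s hs')
      (hε.hasDerivAt hJ ht (continuousOn_errorMatrix_mulVec ξ_cont h0' ε_cont) hs)
  have deriv_V := fun s hs =>
    hasDerivAt_quadraticForm (transpose_eq_of_posDef h.posDef) (deriv_w s hs)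
  have w_cont : ContinuousOn (fun s => expGroup G (-Real.log |ξ s|) *ᵥ ε s) (Set.Icc 0 t) :=
    (Continuous.matrix_mulVec continuous_fst continuous_snd).comp_continuousOn
      (((continuous_expGroup G).comp_continuousOn
        (ξ_cont.abs.log fun s hs => abs_ne_zero.2 (h0' s hs)).neg).prodMk ε_cont)
  refine antitoneOn_of_hasDerivWithinAt_nonpos (convex_Icc 0 t) ?_
    (fun s hs => (deriv_V s (interior_Icc (α := ℝ) ▸ hs)).hasDerivWithinAt) (fun s _ => ?_)
    (Set.left_mem_Icc.2 (hJ t ht).1) (Set.right_mem_Icc.2 (hJ t ht).1) (hJ t ht).1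
  · exact (Continuous.dotProduct continuous_id
      (continuous_const.matrix_mulVec continuous_id)).comp_continuousOn w_cont
  · rw [mulVec_smul, dotProduct_smul, smul_eq_mul]
    exact mul_nonpos_of_nonneg_of_nonpos zero_le_two (mul_nonpos_of_nonneg_of_nonpos
      (Real.rpow_nonneg (abs_nonneg _) ν) (h.closedLoop_nonpos _))

theorem SolvesLMI.tendsto_error (h : SolvesLMI A C G ρ P Y)
    (hA : A * G = (G + ν • 1) * A) (hC : C * G = C) (hJ : IsTimeInterval J)
    (hξ : ∀ t ∈ J, HasDerivAt ξ (xiField ρ ν (ξ t)) t) (h0 : ∀ t ∈ J, ξ t ≠ 0)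
    (hε : IsSolutionOn J (fun t v => (A + gain G (P⁻¹ * Y) ν (ξ t) * C) *ᵥ v) ε)
    {l : Filter ℝ} (mem : ∀ᶠ t in l, t ∈ J) (lim : Tendsto ξ l (𝓝 0)) : Tendsto ε l (𝓝 0) := by
  set w : ℝ → Fin n → ℝ := fun t => expGroup G (-Real.log |ξ t|) *ᵥ ε t
  obtain ⟨a, a_pos, coercive⟩ := exists_sq_norm_le h.posDef
  obtain ⟨c, c_pos, b, b_pos, decay⟩ := exists_norm_expGroup_mulVec_le h.posDef h.monotone
  have log_lim : Tendsto (fun t => Real.log |ξ t|) l atBot := by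
    simp only [Real.log_abs]
    exact Real.tendsto_log_nhdsNE_zero.comp (tendsto_nhdsWithin_iff.2 ⟨lim, mem.mono h0⟩)
  have bound_lim : Tendsto
      (fun t => b * Real.exp (c * Real.log |ξ t|) * √(a * (w 0 ⬝ᵥ P *ᵥ w 0))) l (𝓝 0) := by
    simpa only [mul_zero, zero_mul, Function.comp_apply] using ((Real.tendsto_exp_atBot.comp
      (log_lim.const_mul_atBot c_pos)).const_mul b).mul_const √(a * (w 0 ⬝ᵥ P *ᵥ w 0))
  refine squeeze_zero_norm' ?_ bound_lim
  filter_upwards [mem, log_lim.eventually_le_atBot 0] with t ht log_le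
  have norm_w_le : ‖w t‖ ≤ √(a * (w 0 ⬝ᵥ P *ᵥ w 0)) :=
    Real.le_sqrt_of_sq_le ((coercive (w t)).trans (mul_le_mul_of_nonneg_left
      (h.quadraticForm_error_le hA hC hJ hξ h0 hε ht fun _ => rfl) a_pos.le))
  calc ‖ε t‖ = ‖expGroup G (Real.log |ξ t|) *ᵥ w t‖ := by
        simpa only [neg_neg] using congrArg norm
          (expGroup_neg_mulVec_expGroup_mulVec G (-Real.log |ξ t|) (ε t)).symm
    _ ≤ b * Real.exp (c * Real.log |ξ t|) * ‖w t‖ := decay _ _ log_le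
    _ ≤ _ := mul_le_mul_of_nonneg_left norm_w_le (by positivity)

end ErrorEquation

section Observer

variable {n m k : ℕ} {A G G₀ P : Matrix (Fin n) (Fin n) ℝ} {B : Matrix (Fin n) (Fin m) ℝ}
  {C : Matrix (Fin k) (Fin n) ℝ} {L Y Y₀ : Matrix (Fin n) (Fin k) ℝ} {ρ ν ξ₀ : ℝ} {J : Set ℝ}
  {u : ℝ → Fin m → ℝ} {x z : ℝ → Fin n → ℝ} {ξ : ℝ → ℝ}

theorem observer_field_sub_plant_field (A : Matrix (Fin n) (Fin n) ℝ)
    (C : Matrix (Fin k) (Fin n) ℝ) (G₀ : Matrix (Fin n) (Fin n) ℝ) (Y₀ M : Matrix (Fin n) (Fin k) ℝ)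
    (b x z : Fin n → ℝ) :
    A *ᵥ z + b + (gainL₀ G₀ Y₀ + M) *ᵥ (C *ᵥ z - C *ᵥ x) - (A *ᵥ x + b) =
      (matA₀ A C G₀ Y₀ + M * C) *ᵥ (z - x) := by
  rw [gainL₀, matA₀, ← mulVec_sub, mulVec_mulVec, Matrix.add_mul, Matrix.neg_mul, add_mulVec,
    add_mulVec, sub_mulVec, neg_mulVec, mulVec_sub A]
  abel

theorem IsPlantSolution.isSolutionOn_error_iff (hx : IsPlantSolution A B J u x) :
    IsSolutionOn J (fun t v => (matA₀ A C G₀ Y₀ + gain G L ν (ξ t) * C) *ᵥ v)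
        (fun t => z t - x t) ↔
      IsSolutionOn J (fun t v => A *ᵥ v + B *ᵥ u t +
        (gainL₀ G₀ Y₀ + gain G L ν (ξ t)) *ᵥ (C *ᵥ v - C *ᵥ x t)) z :=
  hx.sub_iff fun t => observer_field_sub_plant_field A C G₀ Y₀ _ _ (x t) (z t)

theorem IsPlantSolution.exists_isObserverSolution
    (hA : matA₀ A C G₀ Y₀ * G = (G + ν • 1) * matA₀ A C G₀ Y₀) (hC : C * G = C) (hρ : 0 < ρ)
    (hξ₀ : ξ₀ ≠ 0) (hx : IsPlantSolution A B (horizon ρ ν ξ₀) u x)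
    (L : Matrix (Fin n) (Fin k) ℝ) (z₀ : Fin n → ℝ) :
    ∃ z ξ, z 0 = z₀ ∧ ξ 0 = ξ₀ ∧ IsObserverSolution A B C G (gainL₀ G₀ Y₀) L ρ ν
      (horizon ρ ν ξ₀) u (fun t => C *ᵥ x t) z ξ := by
  obtain ⟨ε, ε_zero, hε⟩ := exists_isSolutionOn_error hA hC L hρ.ne'
    (isTimeInterval_horizon ρ ν ξ₀) (fun _ => hasDerivAt_xiFlow hρ hξ₀)
    (fun _ => xiFlow_ne_zero hρ hξ₀) (z₀ - x 0)
  refine ⟨fun t => x t + ε t, xiFlow ρ ν ξ₀, ?_, xiFlow_zero ρ ν ξ₀,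
    hx.isSolutionOn_error_iff.1 ?_, isSolutionOn_xiFlow hρ hξ₀⟩
  · simp only [ε_zero, add_sub_cancel]
  · simpa only [add_sub_cancel_left] using hε

theorem IsObserverSolution.tendsto_error
    (h : SolvesLMI (matA₀ A C G₀ Y₀) C G ρ P Y)
    (hA : matA₀ A C G₀ Y₀ * G = (G + ν • 1) * matA₀ A C G₀ Y₀) (hC : C * G = C) (hρ : 0 < ρ)
    (hξ₀ : ξ₀ ≠ 0) (hx : IsPlantSolution A B (horizon ρ ν ξ₀) u x) (ξ_zero : ξ 0 = ξ₀)
    (hz : IsObserverSolution A B C G (gainL₀ G₀ Y₀) (P⁻¹ * Y) ρ ν (horizon ρ ν ξ₀) u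
      (fun t => C *ᵥ x t) z ξ) :
    Tendsto (fun t => (z t - x t, ξ t)) (toHorizon ρ ν ξ₀) (𝓝 (0, 0)) := by
  have hJ := isTimeInterval_horizon ρ ν ξ₀
  have mem := eventually_mem_horizon (ν := ν) hρ hξ₀
  have ξ_eq := hz.2.eqOn_xiFlow ξ_zero hρ hξ₀
  have error := (hx.isSolutionOn_error_iff.2 hz.1).congr_field hJ
    (g := fun t v => (matA₀ A C G₀ Y₀ + gain G (P⁻¹ * Y) ν (xiFlow ρ ν ξ₀ t) * C) *ᵥ v)
    fun t ht v => by rw [ξ_eq ht]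
  exact (h.tendsto_error hA hC hJ (fun _ => hasDerivAt_xiFlow hρ hξ₀)
    (fun _ => xiFlow_ne_zero hρ hξ₀) error mem (tendsto_xiFlow hρ hξ₀)).prodMk_nhds
    ((tendsto_xiFlow hρ hξ₀).congr' (mem.mono fun t ht => (ξ_eq ht).symm))

end Observer

theorem theorem2_general {n m k : ℕ} (A : Matrix (Fin n) (Fin n) ℝ)
    (B : Matrix (Fin n) (Fin m) ℝ) (C : Matrix (Fin k) (Fin n) ℝ) {N : ℕ}
    (hrank : (obsMatrix A C N).rank = n) :
    (∃ (G₀ : Matrix (Fin n) (Fin n) ℝ) (Y₀ : Matrix (Fin n) (Fin k) ℝ),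
      A * G₀ - G₀ * A + Y₀ * C = A ∧ C * G₀ = 0 ∧ IsUnit (1 + G₀)) ∧
    ∀ (G₀ : Matrix (Fin n) (Fin n) ℝ) (Y₀ : Matrix (Fin n) (Fin k) ℝ),
      A * G₀ - G₀ * A + Y₀ * C = A → C * G₀ = 0 → IsUnit (1 + G₀) →
      IsHomogenizing A C N G₀ Y₀ ∧
      ∀ ν : ℝ, AntiHurwitz (genD G₀ ν) → ∀ ρ : ℝ, 0 < ρ →
      (∃ (P : Matrix (Fin n) (Fin n) ℝ) (Y : Matrix (Fin n) (Fin k) ℝ),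
        SolvesLMI (matA₀ A C G₀ Y₀) C (genD G₀ ν) ρ P Y) ∧
      (IsDilation (expGroup (genD G₀ ν)) ∧ IsDilation (extGroup (genD G₀ ν)) ∧
        ∀ L : Matrix (Fin n) (Fin k) ℝ,
          IsHomogeneousOn (extGroup (genD G₀ ν))
            (errorField (matA₀ A C G₀ Y₀) C (genD G₀ ν) L ρ ν) ν
            {e | e (Sum.inr ()) ≠ 0}) ∧
      (∀ (P : Matrix (Fin n) (Fin n) ℝ) (Y : Matrix (Fin n) (Fin k) ℝ),
        SolvesLMI (matA₀ A C G₀ Y₀) C (genD G₀ ν) ρ P Y →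
        ∀ ξ₀ : ℝ, ξ₀ ≠ 0 → ∀ (u : ℝ → Fin m → ℝ) (x : ℝ → Fin n → ℝ),
        IsPlantSolution A B (horizon ρ ν ξ₀) u x →
        (∀ z₀ : Fin n → ℝ, ∃ (z : ℝ → Fin n → ℝ) (ξ : ℝ → ℝ), z 0 = z₀ ∧ ξ 0 = ξ₀ ∧
          IsObserverSolution A B C (genD G₀ ν) (gainL₀ G₀ Y₀) (P⁻¹ * Y) ρ ν (horizon ρ ν ξ₀)
            u (fun t => C *ᵥ x t) z ξ) ∧
        (∀ (z : ℝ → Fin n → ℝ) (ξ : ℝ → ℝ), ξ 0 = ξ₀ →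
          IsObserverSolution A B C (genD G₀ ν) (gainL₀ G₀ Y₀) (P⁻¹ * Y) ρ ν (horizon ρ ν ξ₀)
            u (fun t => C *ᵥ x t) z ξ →
          Tendsto (fun t => (z t - x t, ξ t)) (toHorizon ρ ν ξ₀) (𝓝 (0, 0)))) := by
  refine ⟨exists_homogenizing_matrix hrank, fun G₀ Y₀ eqn eqnC hinv =>
    ⟨isHomogenizing_of_eqn hrank eqn eqnC hinv, fun ν hν ρ hρ => ?_⟩⟩
  have hA := matA₀_mul_genD eqn eqnC hinv ν
  have hC := mul_genD eqnC ν
  obtain ⟨P₁, Y₁, h₁⟩ := exists_solvesLMI hrank eqn eqnC hinv hν ρ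
  have dilation := isDilation_expGroup h₁.posDef h₁.monotone
  exact ⟨⟨P₁, Y₁, h₁⟩,
    ⟨dilation, isDilation_extGroup dilation, fun L => isHomogeneousOn_errorField hA hC L ρ⟩,
    fun P Y hPY ξ₀ hξ₀ u x hx =>
      ⟨fun z₀ => hx.exists_isObserverSolution hA hC hρ hξ₀ (P⁻¹ * Y) z₀,
        fun z ξ ξ_zero hz => hz.tendsto_error hPY hA hC hρ hξ₀ hx ξ_zero⟩⟩

theorem theorem2 {n m k : ℕ} (A : Matrix (Fin n) (Fin n) ℝ) (B : Matrix (Fin n) (Fin m) ℝ)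
    (C : Matrix (Fin k) (Fin n) ℝ) (hobs : ObservablePair A C) (N : ℕ) (hN : IsObsIndex A C N) :
    -- 1) solvability of the algebraic equation, with properties a) and b)
    (∃ (G₀ : Matrix (Fin n) (Fin n) ℝ) (Y₀ : Matrix (Fin n) (Fin k) ℝ),
      IsHomogenizing A C N G₀ Y₀) ∧
    -- 2), 3), 4) for every such solution and every admissible degree
    (∀ (G₀ : Matrix (Fin n) (Fin n) ℝ) (Y₀ : Matrix (Fin n) (Fin k) ℝ),
      IsHomogenizing A C N G₀ Y₀ → ∀ ν : ℝ, -1 / (N : ℝ) ≤ ν → ∀ ρ : ℝ, 0 < ρ →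
      -- 2) feasibility of the linear matrix inequality
      (∃ (P : Matrix (Fin n) (Fin n) ℝ) (Y : Matrix (Fin n) (Fin k) ℝ),
        SolvesLMI (matA₀ A C G₀ Y₀) C (genD G₀ ν) ρ P Y) ∧
      -- 3) homogeneity of the error equation
      (IsDilation (expGroup (genD G₀ ν)) ∧ IsDilation (extGroup (genD G₀ ν)) ∧
        ∀ L : Matrix (Fin n) (Fin k) ℝ,
          IsHomogeneousOn (extGroup (genD G₀ ν))
            (errorField (matA₀ A C G₀ Y₀) C (genD G₀ ν) L ρ ν) ν
            {e | e (Sum.inr ()) ≠ 0}) ∧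
      -- 4) existence on `[0, T₀)` and convergence at `T₀`
      (∀ (P : Matrix (Fin n) (Fin n) ℝ) (Y : Matrix (Fin n) (Fin k) ℝ),
        SolvesLMI (matA₀ A C G₀ Y₀) C (genD G₀ ν) ρ P Y →
        ∀ ξ₀ : ℝ, ξ₀ ≠ 0 → ∀ (u : ℝ → Fin m → ℝ) (x : ℝ → Fin n → ℝ),
        IsPlantSolution A B (horizon ρ ν ξ₀) u x →
        (∀ z₀ : Fin n → ℝ, ∃ (z : ℝ → Fin n → ℝ) (ξ : ℝ → ℝ), z 0 = z₀ ∧ ξ 0 = ξ₀ ∧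
          IsObserverSolution A B C (genD G₀ ν) (gainL₀ G₀ Y₀) (P⁻¹ * Y) ρ ν (horizon ρ ν ξ₀)
            u (fun t => C *ᵥ x t) z ξ) ∧
        (∀ (z : ℝ → Fin n → ℝ) (ξ : ℝ → ℝ), ξ 0 = ξ₀ →
          IsObserverSolution A B C (genD G₀ ν) (gainL₀ G₀ Y₀) (P⁻¹ * Y) ρ ν (horizon ρ ν ξ₀)
            u (fun t => C *ᵥ x t) z ξ →
          Tendsto (fun t => (z t - x t, ξ t)) (toHorizon ρ ν ξ₀) (𝓝 (0, 0))))) := by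
  obtain ⟨⟨G₀, Y₀, eqn, eqnC, hinv⟩, general⟩ := theorem2_general A B C hN.1.2
  exact ⟨⟨G₀, Y₀, (general G₀ Y₀ eqn eqnC hinv).1⟩, fun G₀ Y₀ h ν hν =>
    (general G₀ Y₀ h.eqn h.eqnC h.invertible).2 ν (h.antiHurwitz ν hν)⟩
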